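/- Let $H$ be a separable complex Hilbert space, $B(H)$ the algebra of bounded linear operators on $H$, $K(H)$ the ideal of compact operators, $C(H)=B(H)/K(H)$ the Calkin algebra with its quotient norm and involution, and $\pi:B(H)\to C(H)$ the quotient map. Let $\mathcal P$ be the set of selfadjoint projections of $C(H)$, a submanifold of the selfadjoint part of $C(H)$, whose tangent space at $p$ is $T_p=\{x=x^*: x=px+xp\}$. It carries the linear connection induced by the reductive structure with horizontal spaces $\{z: z^*=-z,\ pzp=0=(1-p)z(1-p)\}$; that is, the covariant derivative of a tangent field $X$ along a curve $\gamma$ in $\mathcal P$ is $\dot X-[\kappa_\gamma(\dot\gamma),X]$, where $\kappa_p(x)=xp-px$ is the unique horizontal element $z$ at $p$ such that $[z,p]=x$. A geodesic joining $p$ and $q$ is a smooth curve $\delta:[0,1]\to\mathcal P$ with $\delta(0)=p$, $\delta(1)=q$ whose velocity field has zero covariant derivative along $\delta$ (equivalently, $\delta(t)=e^{tz}pe^{-tz}$ with $z$ horizontal at $p$ and $e^{z}pe^{-z}=q$). The length of a piecewise $C^1$ curve $\gamma:[a,b]\to\mathcal P$ is $\int_a^b\|\dot\gamma(t)\|\,dt$,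 and a geodesic is minimal if its length is at most that of every piecewise $C^1$ curve in $\mathcal P$ with the same endpoints. Let $p,q\in\mathcal P$ be proper, i.e. $p,q\ne 0,1$. Then there exists a geodesic of $\mathcal P$ joining $p$ and $q$ if and only if there exist orthogonal projections $P,Q\in B(H)$ with $\pi(P)=p$ and $\pi(Q)=q$ such that the null spaces $N(P-Q-1)$ and $N(P-Q+1)$ are both finite dimensional or both infinite dimensional. Moreover, whenever a geodesic joining $p$ and $q$ exists, there is one that is minimal. -/

import Mathlib

noncomputable section

/-! ### The Calkin algebra of a complex Hilbert space -/

section CalkinAlgebra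

set_option linter.unusedSectionVars false

variable (H : Type*) [NormedAddCommGroup H] [InnerProductSpace ℂ H] [CompleteSpace H]

/-- The ideal of compact operators in the algebra of bounded operators on `H`. -/
def compactIdeal : Ideal (H →L[ℂ] H) where
  carrier := {T | IsCompactOperator T}
  add_mem' hS hT := hS.add hT
  zero_mem' := isCompactOperator_zero
  smul_mem' S _ hT := hT.clm_comp S

instance compactIdeal_isTwoSided : (compactIdeal H).IsTwoSided :=
  ⟨fun S hT => IsCompactOperator.comp_clm (M₁ := H) hT S⟩

instance compactIdeal_isClosed : IsClosed (compactIdeal H : Set (H →L[ℂ] H)) :=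
  isClosed_setOfPred_isCompactOperator

variable {H}

/-- A compact operator is approximated in norm by its compressions `F T`, with `F` an orthogonal
projection of finite rank. -/
theorem exists_finiteRank_approx {T : H →L[ℂ] H} (hT : IsCompactOperator T) {ε : ℝ} (hε : 0 < ε) :
    ∃ F : H →L[ℂ] H, IsStarProjection F ∧ IsCompactOperator F ∧ ‖T - F * T‖ ≤ ε := by
  have hc : TotallyBounded (T '' Metric.closedBall 0 1) :=
    ((hT.isCompact_closure_image_closedBall (f := (T : H →ₗ[ℂ] H)) 1).totallyBounded).subset
      subset_closure
  obtain ⟨t, ht, hcov⟩ := Metric.totallyBounded_iff.1 hc ε hε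
  let U : Submodule ℂ H := Submodule.span ℂ t
  have : FiniteDimensional ℂ U := FiniteDimensional.span_of_finite ℂ ht
  refine ⟨U.starProjection, isStarProjection_starProjection, ?_, ?_⟩
  · have h1 : IsCompactOperator (U.orthogonalProjectionOnto : H →L[ℂ] U) := by
      have : ProperSpace U := FiniteDimensional.proper ℂ U
      exact isCompactOperator_of_locallyCompactSpace_dom U.orthogonalProjectionOnto
    exact IsCompactOperator.continuous_comp h1 (g := ((↑) : U → H)) continuous_subtype_val
  · refine ContinuousLinearMap.opNorm_le_of_unit_norm (𝕜 := ℂ) hε.le fun x hx => ?_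
    have hx' : T x ∈ T '' Metric.closedBall 0 1 := ⟨x, by simp [hx], rfl⟩
    obtain ⟨y, hy, hxy⟩ := Set.mem_iUnion₂.1 (hcov hx')
    have hyU : y ∈ U := Submodule.subset_span hy
    have h2 : ‖T x - U.starProjection (T x)‖ ≤ ‖T x - y‖ := by
      rw [Submodule.starProjection_minimal]
      exact ciInf_le ⟨0, by rintro _ ⟨z, rfl⟩; exact norm_nonneg _⟩ (⟨y, hyU⟩ : U)
    refine h2.trans ?_
    rw [Metric.mem_ball, dist_eq_norm] at hxy
    exact hxy.le

theorem star_mem_compactIdeal {T : H →L[ℂ] H} (hT : T ∈ compactIdeal H) :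
    star T ∈ compactIdeal H := by
  have hcl : star T ∈ closure (compactIdeal H : Set (H →L[ℂ] H)) := by
    refine Metric.mem_closure_iff.2 fun ε hε => ?_
    obtain ⟨F, hF, hFc, hle⟩ := exists_finiteRank_approx hT (half_pos hε)
    refine ⟨star T * F, (compactIdeal H).mul_mem_left _ hFc, ?_⟩
    have h : star T - star T * F = star (T - F * T) := by
      rw [star_sub, star_mul, hF.isSelfAdjoint.star_eq]
    rw [dist_eq_norm, h, norm_star]
    linarith
  rwa [(compactIdeal_isClosed H).closure_eq] at hcl

variable (H)

/-- The Calkin algebra `B(H) / K(H)`. -/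
def Calkin : Type _ := (H →L[ℂ] H) ⧸ compactIdeal H

namespace Calkin

/-- The norm is the quotient norm `‖π(T)‖ = inf {‖T + K‖ | K compact}`. -/
instance instNormedRing : NormedRing (Calkin H) where
  __ := Ideal.Quotient.ring (compactIdeal H)
  norm := (Submodule.Quotient.normedAddCommGroup (compactIdeal H)).norm
  toMetricSpace := (Submodule.Quotient.normedAddCommGroup (compactIdeal H)).toMetricSpace
  dist_eq := (Submodule.Quotient.normedAddCommGroup (compactIdeal H)).dist_eq
  norm_mul_le x y := by
    let N : Norm (Calkin H) := (Submodule.Quotient.normedAddCommGroup (compactIdeal H)).toNorm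
    let mk : (H →L[ℂ] H) → Calkin H := Ideal.Quotient.mk (compactIdeal H)
    have hle : ∀ T : H →L[ℂ] H, ‖mk T‖ ≤ ‖T‖ :=
      fun T => Submodule.Quotient.norm_mk_le (compactIdeal H) T
    have hlt : ∀ (x : Calkin H) {ε : ℝ}, 0 < ε → ∃ T : H →L[ℂ] H, mk T = x ∧ ‖T‖ < ‖x‖ + ε :=
      fun x _ hε => Submodule.Quotient.norm_mk_lt (S := compactIdeal H) x hε
    have key : ∀ ε : ℝ, 0 < ε → N.norm ((Ideal.Quotient.ring (compactIdeal H)).mul x y) ≤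
        (‖x‖ + ε) * (‖y‖ + ε) := by
      intro ε hε
      obtain ⟨S, rfl, hS'⟩ := hlt x hε
      obtain ⟨T, rfl, hT'⟩ := hlt y hε
      exact ((hle (S * T)).trans (norm_mul_le S T)).trans
        (mul_le_mul hS'.le hT'.le (norm_nonneg T) ((norm_nonneg S).trans hS'.le))
    have hlim : Filter.Tendsto (fun ε : ℝ => (‖x‖ + ε) * (‖y‖ + ε)) (nhdsWithin 0 (Set.Ioi 0))
        (nhds (‖x‖ * ‖y‖)) := by
      have : Continuous fun ε : ℝ => (‖x‖ + ε) * (‖y‖ + ε) := by fun_prop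
      simpa using (this.tendsto 0).mono_left nhdsWithin_le_nhds
    exact ge_of_tendsto hlim (by filter_upwards [self_mem_nhdsWithin] with ε hε using key ε hε)

instance instCompleteSpace : CompleteSpace (Calkin H) :=
  Submodule.Quotient.completeSpace (compactIdeal H)

instance instAlgebra : Algebra ℂ (Calkin H) :=
  Ideal.Quotient.algebra (I := compactIdeal H) ℂ

instance instNormedAlgebra : NormedAlgebra ℂ (Calkin H) where
  __ := instAlgebra H
  norm_smul_le c x :=
    (Submodule.Quotient.normedSpace (compactIdeal H) ℂ).norm_smul_le c x

variable {H}

/-- The quotient map, as an algebra homomorphism. -/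
def mkAlg : (H →L[ℂ] H) →ₐ[ℂ] Calkin H := Ideal.Quotient.mkₐ ℂ (compactIdeal H)

theorem mkAlg_surjective : Function.Surjective (mkAlg (H := H)) :=
  Ideal.Quotient.mkₐ_surjective ℂ (compactIdeal H)

theorem mkAlg_eq_iff {S T : H →L[ℂ] H} : mkAlg S = mkAlg T ↔ S - T ∈ compactIdeal H :=
  Ideal.Quotient.eq

theorem norm_mkAlg_le (T : H →L[ℂ] H) : ‖mkAlg T‖ ≤ ‖T‖ :=
  Submodule.Quotient.norm_mk_le (compactIdeal H) T

theorem exists_norm_lt (x : Calkin H) {ε : ℝ} (hε : 0 < ε) :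
    ∃ T : H →L[ℂ] H, mkAlg T = x ∧ ‖T‖ < ‖x‖ + ε :=
  Submodule.Quotient.norm_mk_lt (S := compactIdeal H) x hε

variable (H)

/-- The involution of the Calkin algebra, induced by the adjoint of operators. -/
instance instStarRing : StarRing (Calkin H) where
  star := Quotient.map' (s₁ := Submodule.quotientRel (compactIdeal H))
    (s₂ := Submodule.quotientRel (compactIdeal H)) star (fun S T h => by
      rw [Submodule.quotientRel_def] at h ⊢
      rw [← star_sub]
      exact star_mem_compactIdeal h)
  star_involutive x := by
    obtain ⟨T, rfl⟩ := mkAlg_surjective x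
    exact congrArg mkAlg (star_star T)
  star_mul x y := by
    obtain ⟨S, rfl⟩ := mkAlg_surjective x
    obtain ⟨T, rfl⟩ := mkAlg_surjective y
    exact congrArg mkAlg (star_mul S T)
  star_add x y := by
    obtain ⟨S, rfl⟩ := mkAlg_surjective x
    obtain ⟨T, rfl⟩ := mkAlg_surjective y
    exact congrArg mkAlg (star_add S T)

theorem star_mkAlg (T : H →L[ℂ] H) : star (mkAlg T) = mkAlg (star T) := rfl

instance instStarModule : StarModule ℂ (Calkin H) where
  star_smul c x := by
    obtain ⟨T, rfl⟩ := mkAlg_surjective x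
    exact congrArg mkAlg (star_smul c T)

instance instCStarRing : CStarRing (Calkin H) where
  norm_mul_self_le x := by
    obtain ⟨T, rfl⟩ := mkAlg_surjective x
    rw [star_mkAlg, ← map_mul]
    refine le_of_forall_pos_le_add fun ε hε => ?_
    obtain ⟨R, hR, hR'⟩ := exists_norm_lt (mkAlg (star T * T)) (half_pos hε)
    have hK : star T * T - R ∈ compactIdeal H := mkAlg_eq_iff.1 hR.symm
    obtain ⟨F, hF, hFc, hle⟩ := exists_finiteRank_approx hK (half_pos hε)
    have hG : IsStarProjection (1 - F) := hF.one_sub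
    have hG1 : ‖1 - F‖ ≤ 1 := hG.norm_le
    have hTG : mkAlg (T * (1 - F)) = mkAlg T := by
      rw [mkAlg_eq_iff, mul_sub, mul_one, sub_sub_cancel_left]
      exact neg_mem ((compactIdeal H).mul_mem_left _ hFc)
    have h1 : ‖mkAlg T‖ ≤ ‖T * (1 - F)‖ := by rw [← hTG]; exact norm_mkAlg_le _
    have h2 : star (T * (1 - F)) * (T * (1 - F)) =
        ((1 - F) * R + (star T * T - R - F * (star T * T - R))) * (1 - F) := by
      rw [star_mul, hG.isSelfAdjoint.star_eq]
      noncomm_ring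
    calc ‖mkAlg T‖ * ‖mkAlg T‖ ≤ ‖T * (1 - F)‖ * ‖T * (1 - F)‖ := by gcongr
      _ = ‖star (T * (1 - F)) * (T * (1 - F))‖ := CStarRing.norm_star_mul_self.symm
      _ ≤ ‖(1 - F) * R + (star T * T - R - F * (star T * T - R))‖ * ‖1 - F‖ := by
          rw [h2]; exact norm_mul_le _ _
      _ ≤ (‖1 - F‖ * ‖R‖ + ε / 2) * 1 := by
          gcongr
          exact (norm_add_le _ _).trans (add_le_add (norm_mul_le _ _) hle)
      _ ≤ ‖mkAlg (star T * T)‖ + ε := by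
          have : ‖1 - F‖ * ‖R‖ ≤ 1 * ‖R‖ := by gcongr
          linarith

instance instCStarAlgebra : CStarAlgebra (Calkin H) where
  toNormedRing := instNormedRing H
  toStarRing := instStarRing H
  toCompleteSpace := instCompleteSpace H
  toCStarRing := instCStarRing H
  toNormedAlgebra := instNormedAlgebra H
  toStarModule := instStarModule H

variable {H}

/-- The quotient map `π : B(H) → B(H) / K(H)`. -/
def π : (H →L[ℂ] H) →⋆ₐ[ℂ] Calkin H where
  __ := mkAlg
  map_star' _ := rfl

theorem π_eq_iff {S T : H →L[ℂ] H} : π S = π T ↔ IsCompactOperator (S - T) := mkAlg_eq_iff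

end Calkin

end CalkinAlgebra

/-! ### Geometry of the manifold of projections of a C⋆-algebra -/

namespace ProjectionManifold

section Geometry

variable {A : Type*} [CStarAlgebra A]

/-- The tangent space at the projection `p` of the manifold of selfadjoint projections of `A`. -/
def tangentSpace (p : A) : Set A := {x | star x = x ∧ x = p * x + x * p}

/-- The horizontal space at `p` of the reductive structure: the antihermitian elements of `A` that
are `p`-codiagonal. It is a supplement of the isotropy algebra `{y | y* = -y, y p = p y}`. -/
def horizontalSpace (p : A) : Set A :=
  {z | star z = -z ∧ p * z * p = 0 ∧ (1 - p) * z * (1 - p) = 0}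

/-- The 1-form of the reductive structure: the tangent vector `x` at `p` is sent to the
horizontal element `κ_p(x)` which generates it, i.e. to the only `z` in the horizontal space at
`p` with `d/dt (e^{tz} p e^{-tz}) = z p - p z = x` at `t = 0`; see `horizontalLift_spec`. -/
def horizontalLift (p x : A) : A := x * p - p * x

theorem horizontalLift_spec {p x : A} (hp : IsStarProjection p) (hx : x ∈ tangentSpace p) :
    (horizontalLift p x ∈ horizontalSpace p ∧
        horizontalLift p x * p - p * horizontalLift p x = x) ∧
      ∀ z ∈ horizontalSpace p, z * p - p * z = x → z = horizontalLift p x := by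
  have hpp : p * p = p := hp.isIdempotentElem
  have hpp' : ∀ y : A, p * (p * y) = p * y := fun y => by rw [← mul_assoc, hpp]
  have hps : star p = p := hp.isSelfAdjoint
  obtain ⟨hxs, hx⟩ := hx
  have hpxp : p * (x * p) = 0 := by
    have h := congrArg (fun y => p * y * p) hx
    simp only [mul_add, add_mul, mul_assoc, hpp, hpp'] at h
    simpa using h
  refine ⟨⟨⟨?_, ?_, ?_⟩, ?_⟩, ?_⟩
  · simp [horizontalLift, hxs, hps]
  · simp [horizontalLift, mul_sub, mul_assoc, hpp', hpxp]
  · simp only [horizontalLift, mul_sub, sub_mul, mul_assoc, hpp, hpp', hpxp, one_mul, mul_one]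
    simp
  · simp only [horizontalLift, mul_sub, sub_mul, mul_assoc, hpp, hpp', hpxp]
    rw [sub_zero, zero_sub, sub_neg_eq_add, add_comm]
    exact hx.symm
  · rintro z ⟨-, h1, h2⟩ rfl
    simp only [mul_sub, sub_mul, mul_assoc, one_mul, mul_one] at h1 h2
    simp only [horizontalLift, mul_sub, sub_mul, mul_assoc, hpp, hpp', h1]
    rw [h1, sub_zero] at h2
    rw [sub_zero, zero_sub, sub_neg_eq_add, ← sub_eq_zero, ← h2]
    abel

/-- The covariant derivative at time `t`, along the curve `γ : [0, 1] → A` of projections, of the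
field `X` of tangent vectors along `γ`, for the linear connection induced by the reductive
structure. Parallel fields are those of the form `Γ(t) X₀ Γ(t)*`, with `Γ` the horizontal lift
of `γ` to the unitary group, i.e. the solution of `Γ' = κ_γ(γ') Γ`, `Γ(0) = 1`. -/
def covariantDeriv (γ X : ℝ → A) (t : ℝ) : A :=
  let z := horizontalLift (γ t) (derivWithin γ (Set.Icc 0 1) t)
  derivWithin X (Set.Icc 0 1) t - (z * X t - X t * z)

/-- `δ : [0, 1] → A` is a geodesic of the manifold of projections of `A` joining `p` and `q`:
a smooth curve of projections whose velocity field is parallel along it. -/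
structure IsGeodesicJoining (δ : ℝ → A) (p q : A) : Prop where
  smooth : ContDiffOn ℝ ((⊤ : ℕ∞) : WithTop ℕ∞) δ (Set.Icc 0 1)
  isStarProjection : ∀ t ∈ Set.Icc (0 : ℝ) 1, IsStarProjection (δ t)
  covariantDeriv_eq_zero :
    ∀ t ∈ Set.Icc (0 : ℝ) 1, covariantDeriv δ (derivWithin δ (Set.Icc 0 1)) t = 0
  source : δ 0 = p
  target : δ 1 = q

/-- `γ` is piecewise continuously differentiable on `[a, b]`: there is a subdivision
`a = s 0 < s 1 < ⋯ < s n = b` such that `γ` is of class `C¹` on each `[s i, s (i + 1)]`. -/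
def IsPiecewiseC1 (γ : ℝ → A) (a b : ℝ) : Prop :=
  ∃ (n : ℕ) (s : ℕ → ℝ), s 0 = a ∧ s n = b ∧
    ∀ i < n, s i < s (i + 1) ∧ ContDiffOn ℝ 1 γ (Set.Icc (s i) (s (i + 1)))

/-- The length of the curve `γ : [a, b] → A`, for the norm of `A` at each tangent space. -/
def curveLength (γ : ℝ → A) (a b : ℝ) : ℝ := ∫ t in a..b, ‖deriv γ t‖

/-- The curve `δ : [0, 1] → A` is not longer than any piecewise `C¹` curve of projections of `A`
with the same endpoints. -/
def IsMinimal (δ : ℝ → A) : Prop :=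
  ∀ (a b : ℝ) (γ : ℝ → A), a ≤ b → IsPiecewiseC1 γ a b →
    (∀ t ∈ Set.Icc a b, IsStarProjection (γ t)) → γ a = δ 0 → γ b = δ 1 →
    curveLength δ 0 1 ≤ curveLength γ a b

end Geometry

end ProjectionManifold

end

/-! Geodesics starting at `p` are the orbits `e^{tz} p e^{-tz}` with `z` horizontal: the horizontal
lift of a parallel velocity is constant (`exists_horizontal_of_isGeodesicJoining`). Horizontal `z`
anticommutes with the symmetry `s = 2p - 1`, so the endpoint `q` has symmetry `r = e^{2z} s`.
Joining `p` to `q` therefore means finding a horizontal half logarithm of `r s`.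

Existence of lifts: lift `p` to a projection `P`, lift `z` to a horizontal `Z`, and put `Q = e^Z P
e^{-Z}`. On the exceptional subspaces `N(P - Q - 1) = R(P) ∩ N(Q)` and `N(P - Q + 1) = N(P) ∩ R(Q)`
one has `e^{2Z} = -1`, so `Z` is injective there, and it maps each into the other. Hence both are
finite dimensional or both are not (`finiteDimensional_ker_iff_of_horizontal`).

Existence of a geodesic: for lifts `P`, `Q` write `r s = C + iD` with `C`, `D` selfadjoint and
commuting, and `C² + D² = 1`. If `V` is a sign of `D` anticommuting with `s`, then `z = (i/2)
arccos(C) V` is horizontal, `‖z‖ ≤ π/2` and `e^{2z} = r s` (`exists_horizontal_of_sign`). The sign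
exists in `B(H)`, but it vanishes on the exceptional subspaces, where `C = -1` and `arccos C = π`.
If these are finite dimensional, the defect is compact and vanishes in the Calkin algebra; if both
are infinite dimensional, separability gives a partial isometry exchanging them, which completes the
sign.

Minimality: the construction always gives `‖z‖ ≤ π/2`. A functional `ψ` norming the difference of
the endpoint symmetries turns a curve `γ` of projections into the angle `arccos ψ(2γ - 1)`, whose
speed is at most `2‖γ'‖`, while between the endpoints the angle must grow by at least `2‖z‖`
(`isMinimal_conjExp`). -/

namespace ProjectionManifold

/-! ### Geodesics as orbits of one-parameter unitary groups. -/

section ExponentialCurves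

variable {A : Type*} [CStarAlgebra A]

theorem exp_mul_exp_neg (x : A) : NormedSpace.exp x * NormedSpace.exp (-x) = 1 := by
  let +nondep : NormedAlgebra ℚ A := .restrictScalars ℚ ℂ A
  rw [← NormedSpace.exp_add_of_commute (Commute.refl x).neg_right, add_neg_cancel,
    NormedSpace.exp_zero]

theorem exp_neg_mul_exp (x : A) : NormedSpace.exp (-x) * NormedSpace.exp x = 1 := by
  simpa using exp_mul_exp_neg (-x)

theorem star_exp_of_skew {z : A} (hz : star z = -z) :
    star (NormedSpace.exp z) = NormedSpace.exp (-z) := by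
  let +nondep : NormedAlgebra ℚ A := .restrictScalars ℚ ℂ A
  rw [NormedSpace.star_exp, hz]

theorem exp_mem_unitary {z : A} (hz : star z = -z) : NormedSpace.exp z ∈ unitary A := by
  rw [Unitary.mem_iff, star_exp_of_skew hz]
  exact ⟨exp_neg_mul_exp z, exp_mul_exp_neg z⟩

/-- The orbit of `x` under conjugation by the one-parameter group generated by `z`. -/
noncomputable def conjExp (z x : A) (t : ℝ) : A :=
  NormedSpace.exp (t • z) * x * NormedSpace.exp (-(t • z))

theorem hasDerivAt_conjExp (z x : A) (t : ℝ) :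
    HasDerivAt (conjExp z x) (conjExp z (z * x - x * z) t) t := by
  let +nondep : NormedAlgebra ℚ A := .restrictScalars ℚ ℂ A
  have h1 := hasDerivAt_exp_smul_const (𝕂 := ℝ) z t
  have h2 := hasDerivAt_exp_smul_const' (𝕂 := ℝ) (-z) t
  simp only [smul_neg] at h2
  convert! (h1.mul_const x).mul h2 using 1
  simp only [conjExp]
  noncomm_ring

theorem contDiff_conjExp (z x : A) : ContDiff ℝ ((⊤ : ℕ∞) : WithTop ℕ∞) (conjExp z x) := by
  let +nondep : NormedAlgebra ℚ A := .restrictScalars ℚ ℂ A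
  have h : ContDiff ℝ ((⊤ : ℕ∞) : WithTop ℕ∞) (NormedSpace.exp : A → A) :=
    (contDiff_iff_contDiffAt.2 fun y =>
      ((NormedSpace.exp_analytic (𝕂 := ℝ) y).contDiffAt))
  unfold conjExp
  exact ((h.comp (contDiff_id.smul contDiff_const)).mul contDiff_const).mul
    (h.comp (contDiff_id.smul contDiff_const).neg)

theorem derivWithin_conjExp (z x : A) {t : ℝ} (ht : t ∈ Set.Icc (0 : ℝ) 1) :
    derivWithin (conjExp z x) (Set.Icc 0 1) t = conjExp z (z * x - x * z) t :=
  (hasDerivAt_conjExp z x t).hasDerivWithinAt.derivWithin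
    (uniqueDiffOn_Icc zero_lt_one t ht)

theorem conjExp_mul (z x y : A) (t : ℝ) : conjExp z x t * conjExp z y t = conjExp z (x * y) t := by
  simp only [conjExp]
  have := exp_neg_mul_exp (t • z)
  calc _ = NormedSpace.exp (t • z) * x * (NormedSpace.exp (-(t • z)) * NormedSpace.exp (t • z)) * y
        * NormedSpace.exp (-(t • z)) := by noncomm_ring
    _ = _ := by rw [this]; noncomm_ring

theorem conjExp_sub (z x y : A) (t : ℝ) : conjExp z (x - y) t = conjExp z x t - conjExp z y t := by
  simp only [conjExp]; noncomm_ring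

theorem norm_conjExp {z : A} (hz : star z = -z) (x : A) (t : ℝ) : ‖conjExp z x t‖ = ‖x‖ := by
  have h1 : star (t • z) = -(t • z) := by simp [hz]
  have hU := exp_mem_unitary h1
  have hV := exp_mem_unitary (z := -(t • z)) (by rw [star_neg, h1])
  rw [conjExp, CStarRing.norm_mul_mem_unitary _ hV, CStarRing.norm_mem_unitary_mul _ hU]

theorem isStarProjection_conjExp {z p : A} (hz : star z = -z) (hp : IsStarProjection p) (t : ℝ) :
    IsStarProjection (conjExp z p t) := by
  have h1 : star (t • z) = -(t • z) := by simp [hz]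
  refine ⟨?_, ?_⟩
  · rw [IsIdempotentElem, conjExp_mul, hp.isIdempotentElem.eq]
  · rw [isSelfAdjoint_iff, conjExp]
    simp only [star_mul, hp.isSelfAdjoint.star_eq]
    rw [star_exp_of_skew h1, star_exp_of_skew (by rw [star_neg, h1]), neg_neg, mul_assoc]

theorem codiagonal_of_mem_horizontalSpace {p z : A} (hz : z ∈ horizontalSpace p) :
    z = p * z + z * p := by
  obtain ⟨-, h1, h2⟩ := hz
  have : (1 - p) * z * (1 - p) = z - (p * z + z * p) + p * z * p := by noncomm_ring
  rw [this, h1, add_zero, sub_eq_zero] at h2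
  exact h2

/-- Since the symmetry is unitary, this shows that the velocity has the same norm as `z`. -/
theorem commutator_eq_mul_reflection {p z : A} (hz : z ∈ horizontalSpace p) :
    z * p - p * z = z * (2 * p - 1) := by
  have h := codiagonal_of_mem_horizontalSpace hz
  calc z * p - p * z = 2 * (z * p) - (p * z + z * p) := by noncomm_ring
    _ = z * (2 * p - 1) := by rw [← h]; noncomm_ring

theorem reflection_anticommute {p z : A} (hz : z ∈ horizontalSpace p) :
    (2 * p - 1) * z = -(z * (2 * p - 1)) := by
  have h := codiagonal_of_mem_horizontalSpace hz
  calc (2 * p - 1) * z = 2 * (p * z + z * p) - 2 * z * p - z := by noncomm_ring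
    _ = _ := by rw [← h]; noncomm_ring

theorem reflection_mul_self {p : A} (hp : IsIdempotentElem p) : (2 * p - 1) * (2 * p - 1) = 1 := by
  have : (2 * p - 1) * (2 * p - 1) = 4 * (p * p) - 4 * p + 1 := by noncomm_ring
  rw [this, hp.eq]; noncomm_ring

theorem isGeodesicJoining_conjExp {p z : A} (hp : IsStarProjection p)
    (hz : z ∈ horizontalSpace p) :
    IsGeodesicJoining (conjExp z p) p (NormedSpace.exp z * p * NormedSpace.exp (-z)) where
  smooth := (contDiff_conjExp z p).contDiffOn
  isStarProjection t _ := isStarProjection_conjExp hz.1 hp t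
  covariantDeriv_eq_zero t ht := by
    have hpp := hp.isIdempotentElem.eq
    have h1 : derivWithin (derivWithin (conjExp z p) (Set.Icc 0 1)) (Set.Icc 0 1) t =
        conjExp z (z * (z * p - p * z) - (z * p - p * z) * z) t := by
      rw [derivWithin_congr (fun s hs => derivWithin_conjExp z p hs) (derivWithin_conjExp z p ht),
        derivWithin_conjExp z _ ht]
    -- The horizontal lift of the initial velocity is `z` itself; conjugation transports this to
    -- every time, so the two terms of the covariant derivative cancel.
    have h2 : (z * p - p * z) * p - p * (z * p - p * z) = z := by
      have h3 : (z * p - p * z) * p - p * (z * p - p * z) =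
        z * (p * p) + (p * p) * z - (p * z * p + p * z * p) := by noncomm_ring
      rw [h3, hpp, hz.2.1, add_zero, sub_zero, add_comm, ← codiagonal_of_mem_horizontalSpace hz]
    simp only [covariantDeriv]
    rw [h1, derivWithin_conjExp z p ht, horizontalLift, conjExp_mul, conjExp_mul, ← conjExp_sub,
      h2, conjExp_mul, conjExp_mul, ← conjExp_sub, ← conjExp_sub, sub_self]
    simp [conjExp]
  source := by
    simp [conjExp, NormedSpace.exp_zero]
  target := by simp [conjExp]

/-- The lift `Z = [δ', δ]` has derivative `[δ'', δ]`, and parallelism makes `δ'' = [Z, δ']`. A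
commutator of two codiagonal elements is diagonal, so `Z' = 0`; then `δ' = [z, δ]` with constant
`z`, and `e^{-tz} δ(t) e^{tz}` is constant. -/
theorem exists_horizontal_of_isGeodesicJoining {p q : A} {δ : ℝ → A}
    (h : IsGeodesicJoining δ p q) :
    ∃ z ∈ horizontalSpace p, NormedSpace.exp z * p * NormedSpace.exp (-z) = q := by
  set I := Set.Icc (0 : ℝ) 1 with hI
  have hu : UniqueDiffOn ℝ I := uniqueDiffOn_Icc zero_lt_one
  set δ' := derivWithin δ I with hδ'
  have hd : ∀ t ∈ I, HasDerivWithinAt δ (δ' t) I t := fun t ht =>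
    ((h.smooth.differentiableOn (by simp)) t ht).hasDerivWithinAt
  have hs' : ContDiffOn ℝ 1 δ' I := h.smooth.derivWithin hu (by norm_cast)
  have hd' : ∀ t ∈ I, HasDerivWithinAt δ' (derivWithin δ' I t) I t := fun t ht =>
    ((hs'.differentiableOn (by simp)) t ht).hasDerivWithinAt
  have htan : ∀ t ∈ I, δ' t = δ' t * δ t + δ t * δ' t := fun t ht => by
    have h1 := (hd t ht).mul (hd t ht)
    have h2 := (hd t ht).congr (f₁ := fun t => δ t * δ t)
      (fun s hs => (h.isStarProjection s hs).isIdempotentElem.eq)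
      (h.isStarProjection t ht).isIdempotentElem.eq
    exact (hu t ht).eq_deriv _ h2 h1
  have hstar : ∀ t ∈ I, star (δ' t) = δ' t := fun t ht => by
    have h1 := (hd t ht).star
    have h2 := (hd t ht).congr (f₁ := fun t => star (δ t))
      (fun s hs => (h.isStarProjection s hs).isSelfAdjoint.star_eq)
      (h.isStarProjection t ht).isSelfAdjoint.star_eq
    exact (hu t ht).eq_deriv _ h1 h2
  have hspec : ∀ t ∈ I, _ := fun t ht =>
    horizontalLift_spec (h.isStarProjection t ht) (x := δ' t)
      ⟨hstar t ht, by rw [add_comm]; exact htan t ht⟩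
  -- the horizontal lift of the velocity is constant
  set Z : ℝ → A := fun t => horizontalLift (δ t) (δ' t) with hZ
  have hZd : ∀ t ∈ I, HasDerivWithinAt Z 0 I t := fun t ht => by
    have h1 := ((hd' t ht).mul (hd t ht)).sub ((hd t ht).mul (hd' t ht))
    have hc := h.covariantDeriv_eq_zero t ht
    have hcod := codiagonal_of_mem_horizontalSpace (hspec t ht).1.1
    have ht' := htan t ht
    simp only [covariantDeriv, ← hI, ← hδ'] at hc
    rw [sub_eq_zero] at hc
    refine h1.congr_deriv ?_
    rw [hc]
    generalize horizontalLift (δ t) (δ' t) = z at *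
    generalize δ' t = x at *
    generalize δ t = e at *
    -- Both `z` and `x` are codiagonal for `e`, so moving `e` across two factors turns it into `1 -
    -- e` and back: `z x` and `x z` commute with `e`.
    have e1 : e * z = z - z * e := eq_sub_of_add_eq hcod.symm
    have e2 : e * x = x - x * e := eq_sub_of_add_eq' ht'.symm
    have e3 : e * (z * x) = z * x * e := by
      rw [← mul_assoc, e1, sub_mul, mul_assoc z e x, e2]; noncomm_ring
    have e4 : e * (x * z) = x * z * e := by
      rw [← mul_assoc, e2, sub_mul, mul_assoc x e z, e1]; noncomm_ring
    rw [mul_sub, e3, e4]; noncomm_ring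
  have hIcc0 : (0 : ℝ) ∈ I := by simp [hI]
  have hIcc1 : (1 : ℝ) ∈ I := by simp [hI]
  have hconst : ∀ f : ℝ → A, (∀ t ∈ I, HasDerivWithinAt f 0 I t) → ∀ t ∈ I, f t = f 0 :=
    fun f hf => constant_of_derivWithin_zero (fun t ht => (hf t ht).differentiableWithinAt)
      (fun t ht => (hf t (Set.Ico_subset_Icc_self ht)).derivWithin
        (hu t (Set.Ico_subset_Icc_self ht)))
  have hZc := hconst Z hZd
  refine ⟨Z 0, h.source ▸ (hspec 0 hIcc0).1.1, ?_⟩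
  set z := Z 0
  have hδd : ∀ t ∈ I, δ' t = z * δ t - δ t * z := fun t ht => by
    rw [← hZc t ht]; exact (hspec t ht).1.2.symm
  let +nondep : NormedAlgebra ℚ A := .restrictScalars ℚ ℂ A
  have hf : ∀ t ∈ I, HasDerivWithinAt
      (fun t => NormedSpace.exp (t • -z) * δ t * NormedSpace.exp (t • z)) 0 I t := fun t ht => by
    have h1 := (hasDerivAt_exp_smul_const (𝕂 := ℝ) (-z) t).hasDerivWithinAt (s := I)
    have h2 := (hasDerivAt_exp_smul_const' (𝕂 := ℝ) z t).hasDerivWithinAt (s := I)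
    refine ((h1.mul (hd t ht)).mul h2).congr_deriv ?_
    simp only [hδd t ht, Pi.mul_apply]; noncomm_ring
  have hf1 := hconst _ hf 1 hIcc1
  simp only [one_smul, zero_smul, NormedSpace.exp_zero, one_mul, mul_one, h.source,
    h.target] at hf1
  rw [← hf1]
  calc _ = (NormedSpace.exp z * NormedSpace.exp (-z)) * q *
        (NormedSpace.exp z * NormedSpace.exp (-z)) := by noncomm_ring
    _ = q := by rw [exp_mul_exp_neg, one_mul, mul_one]

end ExponentialCurves

end ProjectionManifold

namespace ProjectionManifold

/-! ### Geodesics generated by `z` with `‖z‖ ≤ π / 2` are minimal. -/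

section Minimality

variable {A : Type*} [CStarAlgebra A]

open MeasureTheory Real

theorem isSelfAdjoint_reflection {p : A} (hp : IsSelfAdjoint p) : IsSelfAdjoint (2 * p - 1) := by
  rw [two_mul]
  exact (hp.add hp).sub (.one A)

theorem reflection_mem_unitary {p : A} (hp : IsStarProjection p) : 2 * p - 1 ∈ unitary A := by
  have h := reflection_mul_self hp.isIdempotentElem
  rw [Unitary.mem_iff, (isSelfAdjoint_reflection hp.isSelfAdjoint).star_eq]
  exact ⟨h, h⟩

theorem norm_one_le_one : ‖(1 : A)‖ ≤ 1 := by
  cases subsingleton_or_nontrivial A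
  · simp [Subsingleton.elim (1 : A) 0]
  · exact CStarRing.norm_one.le

theorem norm_reflection_le {p : A} (hp : IsStarProjection p) : ‖2 * p - 1‖ ≤ 1 := by
  have h := CStarRing.norm_mem_unitary_mul (1 : A) (reflection_mem_unitary hp)
  rw [mul_one] at h
  exact h ▸ norm_one_le_one

/-- A contractive functional restricts to a contraction on the plane spanned by a selfadjoint
unitary `s` and a selfadjoint element `k` anticommuting with it. -/
theorem sq_apply_le_of_anticommute {s k : A} (hs : IsSelfAdjoint s) (hss : s * s = 1)
    (hk : IsSelfAdjoint k) (hsk : s * k = -(k * s)) {ψ : A →L[ℝ] ℝ} (hψ : ‖ψ‖ ≤ 1) :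
    ψ k ^ 2 ≤ ‖k‖ ^ 2 * (1 - ψ s ^ 2) := by
  have key : ∀ x y : ℝ, (x * ψ s + y * ψ k) ^ 2 ≤ x ^ 2 + y ^ 2 * ‖k‖ ^ 2 := fun x y => by
    have h1 : |x * ψ s + y * ψ k| ≤ ‖x • s + y • k‖ := by
      have := ψ.le_of_opNorm_le hψ (x • s + y • k)
      simpa using this
    -- The cross terms of the square cancel by anticommutation.
    have h2 : ‖x • s + y • k‖ ^ 2 = ‖(x ^ 2) • (1 : A) + (y ^ 2) • (k * k)‖ := by
      have hsa : IsSelfAdjoint (x • s + y • k) :=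
        ((IsSelfAdjoint.all x).smul hs).add ((IsSelfAdjoint.all y).smul hk)
      rw [sq, ← CStarRing.norm_star_mul_self, hsa.star_eq]
      congr 1
      simp only [mul_add, add_mul, smul_mul_smul_comm, hss, hsk]
      rw [mul_comm y x]
      simp only [smul_neg, sq]
      abel
    calc (x * ψ s + y * ψ k) ^ 2 = |x * ψ s + y * ψ k| ^ 2 := (sq_abs _).symm
      _ ≤ ‖x • s + y • k‖ ^ 2 := by gcongr
      _ ≤ ‖(x ^ 2) • (1 : A)‖ + ‖(y ^ 2) • (k * k)‖ := by rw [h2]; exact norm_add_le _ _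
      _ ≤ x ^ 2 * 1 + y ^ 2 * (‖k‖ * ‖k‖) := by
        rw [norm_smul, norm_smul, Real.norm_of_nonneg (sq_nonneg x),
          Real.norm_of_nonneg (sq_nonneg y)]
        gcongr
        · exact norm_one_le_one
        · exact norm_mul_le _ _
      _ = _ := by ring
  -- These coefficients are the equality case of Cauchy–Schwarz for the dual quadratic form.
  have h := key (ψ s * ‖k‖ ^ 2) (ψ k)
  have h' : (‖k‖ ^ 2 * ψ s ^ 2 + ψ k ^ 2) * (‖k‖ ^ 2 * ψ s ^ 2 + ψ k ^ 2) ≤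
      ‖k‖ ^ 2 * (‖k‖ ^ 2 * ψ s ^ 2 + ψ k ^ 2) := by linarith
  have h0 : 0 ≤ ‖k‖ ^ 2 * ψ s ^ 2 + ψ k ^ 2 := by positivity
  rcases h0.eq_or_lt with h0 | h0
  · have : 0 ≤ ‖k‖ ^ 2 := by positivity
    linarith
  · linarith [le_of_mul_le_mul_right h' h0]

/-- The two-sided `deriv` agrees with the continuous one-sided derivative except perhaps at the
endpoints, a null set. -/
theorem integrableOn_norm_deriv {γ : ℝ → A} {a b : ℝ} (hab : a < b)
    (hγ : ContDiffOn ℝ 1 γ (Set.Icc a b)) :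
    IntegrableOn (fun t => ‖deriv γ t‖) (Set.Icc a b) := by
  have h1 : ContinuousOn (derivWithin γ (Set.Icc a b)) (Set.Icc a b) :=
    hγ.continuousOn_derivWithin (uniqueDiffOn_Icc hab) le_rfl
  have h2 : IntegrableOn (fun t => ‖derivWithin γ (Set.Icc a b) t‖) (Set.Icc a b) :=
    h1.norm.integrableOn_Icc
  rw [integrableOn_Icc_iff_integrableOn_Ioo] at h2 ⊢
  refine h2.congr_fun (fun t ht => ?_) measurableSet_Ioo
  simp only [derivWithin_of_mem_nhds (Icc_mem_nhds ht.1 ht.2)]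

/-- The velocity `γ'` anticommutes with the symmetry `2γ - 1`, so `u = ψ(2γ - 1)` satisfies `|u'| ≤
2 ‖γ'‖ √(1 - u²)`. This bounds the speed of `arccos u` by `2 ‖γ'‖`. -/
theorem arccos_sub_arccos_le_of_contDiffOn {γ : ℝ → A} {a b : ℝ} (hab : a < b)
    (hγ : ContDiffOn ℝ 1 γ (Set.Icc a b)) (hp : ∀ t ∈ Set.Icc a b, IsStarProjection (γ t))
    {ψ : A →L[ℝ] ℝ} (hψ : ‖ψ‖ ≤ 1) :
    arccos (ψ (2 * γ b - 1)) - arccos (ψ (2 * γ a - 1)) ≤ 2 * ∫ t in a..b, ‖deriv γ t‖ := by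
  set u : ℝ → ℝ := fun t => ψ (2 * γ t - 1) with hu
  have hu1 : ∀ t ∈ Set.Icc a b, |u t| ≤ 1 := fun t ht => by
    have := ψ.le_of_opNorm_le hψ (2 * γ t - 1)
    rw [one_mul] at this
    exact this.trans (norm_reflection_le (hp t ht))
  have hlip : ∀ t ∈ Set.Ioo a b, HasDerivAt u (2 * ψ (deriv γ t)) t ∧
      ψ (deriv γ t) ^ 2 ≤ ‖deriv γ t‖ ^ 2 * (1 - u t ^ 2) := fun t ht => by
    have hnhds := Icc_mem_nhds ht.1 ht.2
    have htI := Set.Ioo_subset_Icc_self ht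
    have hd : HasDerivAt γ (deriv γ t) t :=
      ((hγ.differentiableOn (by simp)) t htI).differentiableAt hnhds |>.hasDerivAt
    have hev : ∀ᶠ s in nhds t, IsStarProjection (γ s) := by
      filter_upwards [hnhds] with s hs using hp s hs
    have htan : deriv γ t = deriv γ t * γ t + γ t * deriv γ t :=
      hd.unique ((hd.mul hd).congr_of_eventuallyEq
        (hev.mono fun s hs => hs.isIdempotentElem.eq.symm))
    have hsa : IsSelfAdjoint (deriv γ t) :=
      (hd.star.congr_of_eventuallyEq
        (hev.mono fun s hs => hs.isSelfAdjoint.star_eq.symm)).unique hd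
    refine ⟨?_, sq_apply_le_of_anticommute (isSelfAdjoint_reflection (hp t htI).isSelfAdjoint)
      (reflection_mul_self (hp t htI).isIdempotentElem) hsa ?_ hψ⟩
    · have h1 := ψ.hasFDerivAt.comp_hasDerivAt t ((hd.const_mul 2).sub_const 1)
      refine h1.congr_deriv ?_
      rw [two_mul, map_add, two_mul]
    · have h2 : (2 * γ t - 1) * deriv γ t + deriv γ t * (2 * γ t - 1) =
          2 * (deriv γ t * γ t + γ t * deriv γ t) - 2 * deriv γ t := by noncomm_ring
      rw [← htan, sub_self] at h2
      exact eq_neg_of_add_eq_zero_left h2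
  have hcont : ContinuousOn u (Set.Icc a b) :=
    ψ.continuous.comp_continuousOn ((continuousOn_const.mul hγ.continuousOn).sub continuousOn_const)
  have hint := (integrableOn_norm_deriv hab hγ).const_mul 2
  -- The factor `c < 1` keeps the argument away from `±1`, where `arccos` is not differentiable; `c
  -- → 1` at the end.
  have main : ∀ c ∈ Set.Ioo (0 : ℝ) 1,
      arccos (c * u b) - arccos (c * u a) ≤ 2 * ∫ t in a..b, ‖deriv γ t‖ := fun c hc => by
    rw [← intervalIntegral.integral_const_mul]
    refine intervalIntegral.sub_le_integral_of_hasDeriv_right_of_le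
      (g := fun t => arccos (c * u t))
      (g' := fun t => -(1 / √(1 - (c * u t) ^ 2)) * (c * (2 * ψ (deriv γ t)))) hab.le
      (continuous_arccos.comp_continuousOn (continuousOn_const.mul hcont)) ?_ hint ?_
    · intro t ht
      have h1 := hu1 t (Set.Ioo_subset_Icc_self ht)
      have h2 : |c * u t| < 1 := by
        rw [abs_mul, abs_of_pos hc.1]
        nlinarith [hc.1, hc.2, abs_nonneg (u t)]
      rw [abs_lt] at h2
      exact ((hasDerivAt_arccos h2.1.ne' h2.2.ne).comp t
        ((hlip t ht).1.const_mul c)).hasDerivWithinAt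
    · intro t ht
      have h1 := hu1 t (Set.Ioo_subset_Icc_self ht)
      have h3 := (hlip t ht).2
      have hu2 : u t ^ 2 ≤ 1 := by rwa [sq_le_one_iff_abs_le_one]
      have hc2 : c ^ 2 < 1 := by nlinarith [hc.1, hc.2]
      have hpos : 0 < 1 - (c * u t) ^ 2 := by
        rw [mul_pow]; nlinarith [sq_nonneg c, sq_nonneg (u t)]
      have h4 : (c * ψ (deriv γ t)) ^ 2 ≤ (‖deriv γ t‖ * √(1 - (c * u t) ^ 2)) ^ 2 := by
        rw [mul_pow, mul_pow ‖deriv γ t‖, Real.sq_sqrt hpos.le]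
        calc c ^ 2 * ψ (deriv γ t) ^ 2 ≤ c ^ 2 * (‖deriv γ t‖ ^ 2 * (1 - u t ^ 2)) := by gcongr
          _ = ‖deriv γ t‖ ^ 2 * (c ^ 2 - (c * u t) ^ 2) := by ring
          _ ≤ _ := by gcongr
      have h5 := abs_le_of_sq_le_sq h4 (by positivity)
      have h6 := Real.sqrt_pos.2 hpos
      have : -(1 / √(1 - (c * u t) ^ 2)) * (c * (2 * ψ (deriv γ t))) =
          2 * (-(c * ψ (deriv γ t)) / √(1 - (c * u t) ^ 2)) := by ring
      show _ ≤ 2 * ‖deriv γ t‖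
      rw [this]
      gcongr
      rw [div_le_iff₀ h6]
      linarith [(abs_le.1 h5).1]
  have htend : ∀ x : ℝ, Filter.Tendsto (fun c : ℝ => arccos (c * x)) (nhdsWithin 1 (Set.Iio 1))
      (nhds (arccos x)) := fun x => by
    have h : Continuous fun c : ℝ => arccos (c * x) :=
      continuous_arccos.comp (continuous_id.mul continuous_const)
    simpa using (h.tendsto 1).mono_left nhdsWithin_le_nhds
  refine le_of_tendsto ((htend (u b)).sub (htend (u a))) ?_
  filter_upwards [Ioo_mem_nhdsLT (zero_lt_one' ℝ)] with c hc using main c hc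

theorem arccos_sub_arccos_le_curveLength {γ : ℝ → A} {a b : ℝ}
    (hγ : IsPiecewiseC1 γ a b) (hp : ∀ t ∈ Set.Icc a b, IsStarProjection (γ t))
    {ψ : A →L[ℝ] ℝ} (hψ : ‖ψ‖ ≤ 1) :
    arccos (ψ (2 * γ b - 1)) - arccos (ψ (2 * γ a - 1)) ≤ 2 * curveLength γ a b := by
  obtain ⟨n, s, rfl, rfl, hs⟩ := hγ
  have hmono : ∀ i j, i ≤ j → j ≤ n → s i ≤ s j := fun i j hij => by
    induction j, hij using Nat.le_induction with
    | base => exact fun _ => le_rfl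
    | succ j _ ih => exact fun hj => (ih (by omega)).trans (hs j (by omega)).1.le
  have key : ∀ i ≤ n, IntervalIntegrable (fun t => ‖deriv γ t‖) volume (s 0) (s i) ∧
      arccos (ψ (2 * γ (s i) - 1)) - arccos (ψ (2 * γ (s 0) - 1)) ≤
        2 * ∫ t in s 0..s i, ‖deriv γ t‖ := fun i => by
    induction i with
    | zero => simp
    | succ i ih =>
      intro hi
      obtain ⟨h1, h2⟩ := ih (by omega)
      obtain ⟨h3, h4⟩ := hs i (by omega)
      have h5 : IntervalIntegrable (fun t => ‖deriv γ t‖) volume (s i) (s (i + 1)) :=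
        (intervalIntegrable_iff_integrableOn_Icc_of_le h3.le).2 (integrableOn_norm_deriv h3 h4)
      have h6 := arccos_sub_arccos_le_of_contDiffOn h3 h4 (fun t ht => hp t
        ⟨(hmono 0 i (by omega) (by omega)).trans ht.1, ht.2.trans (hmono _ n hi le_rfl)⟩) hψ
      refine ⟨h1.trans h5, ?_⟩
      rw [← intervalIntegral.integral_add_adjacent_intervals h1 h5]
      linarith
  exact (key n le_rfl).2

theorem reflection_mul_exp {p z : A} (hz : z ∈ horizontalSpace p) :
    (2 * p - 1) * NormedSpace.exp (-z) = NormedSpace.exp z * (2 * p - 1) := by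
  let +nondep : NormedAlgebra ℚ A := .restrictScalars ℚ ℂ A
  have h : SemiconjBy (2 * p - 1) (-z) z := by
    rw [SemiconjBy, mul_neg, reflection_anticommute hz, neg_neg]
  exact h.exp_right

/-- Anticommutation gives `s e^{-z} = e^z s`, so conjugating `s` by `e^z` doubles the exponent on
the left. -/
theorem reflection_conj_exp {p z : A} (hz : z ∈ horizontalSpace p) :
    2 * (NormedSpace.exp z * p * NormedSpace.exp (-z)) - 1 =
      NormedSpace.exp (2 • z) * (2 * p - 1) := by
  let +nondep : NormedAlgebra ℚ A := .restrictScalars ℚ ℂ A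
  rw [two_smul, NormedSpace.exp_add_of_commute (Commute.refl z),
    mul_assoc (NormedSpace.exp z) (NormedSpace.exp z), ← reflection_mul_exp hz]
  calc _ = 2 * (NormedSpace.exp z * p * NormedSpace.exp (-z)) -
        NormedSpace.exp z * NormedSpace.exp (-z) := by rw [exp_mul_exp_neg]
    _ = _ := by noncomm_ring

/-- Up to sign the difference is `(e^{2z} - 1) s` with `s` unitary, and `2z = ix` for a selfadjoint
`x` of norm `2‖z‖ ≤ π`, so that `‖e^{ix} - 1‖² = 2(1 - cos ‖x‖)`. -/
theorem norm_reflection_sub_conj {p z : A} (hp : IsStarProjection p) (hz : z ∈ horizontalSpace p)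
    (hzn : ‖z‖ ≤ π / 2) :
    ‖(2 * p - 1) - (2 * (NormedSpace.exp z * p * NormedSpace.exp (-z)) - 1)‖ = 2 * sin ‖z‖ := by
  let +nondep : NormedAlgebra ℚ A := .restrictScalars ℚ ℂ A
  have hsa : IsSelfAdjoint ((-(2 * Complex.I)) • z) := by
    rw [isSelfAdjoint_iff, star_smul, hz.1]
    simp
  let x : selfAdjoint A := ⟨_, hsa⟩
  have hx : ‖x‖ = 2 * ‖z‖ := by
    show ‖(-(2 * Complex.I)) • z‖ = _
    rw [norm_smul]; simp
  have h2 := selfAdjoint.norm_sq_expUnitary_sub_one (x := x) (by rw [hx]; linarith)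
  have h3 : (selfAdjoint.expUnitary x : A) = NormedSpace.exp (2 • z) := by
    rw [selfAdjoint.expUnitary_coe]
    congr 1
    show Complex.I • (-(2 * Complex.I)) • z = _
    rw [smul_smul]
    have : Complex.I * -(2 * Complex.I) = 2 := by
      linear_combination (-2) * Complex.I_mul_I
    rw [this, two_smul, two_smul]
  rw [h3, hx] at h2
  have h4 : (2 * p - 1) - NormedSpace.exp (2 • z) * (2 * p - 1) =
      -((NormedSpace.exp (2 • z) - 1) * (2 * p - 1)) := by noncomm_ring
  rw [reflection_conj_exp hz, h4, norm_neg,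
    CStarRing.norm_mul_mem_unitary _ (reflection_mem_unitary hp)]
  have h5 : 0 ≤ sin ‖z‖ := sin_nonneg_of_nonneg_of_le_pi (norm_nonneg z)
    (by linarith [pi_pos])
  refine (sq_eq_sq₀ (norm_nonneg _) (by positivity)).1 ?_
  rw [h2, cos_two_mul]
  linarith [sin_sq_add_cos_sq ‖z‖]

theorem curveLength_conjExp {p z : A} (hp : IsStarProjection p) (hz : z ∈ horizontalSpace p) :
    curveLength (conjExp z p) 0 1 = ‖z‖ := by
  have h : ∀ t, ‖deriv (conjExp z p) t‖ = ‖z‖ := fun t => by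
    rw [(hasDerivAt_conjExp z p t).deriv, norm_conjExp hz.1, commutator_eq_mul_reflection hz,
      CStarRing.norm_mul_mem_unitary _ (reflection_mem_unitary hp)]
  simp [curveLength, h]

/-- With `x = cos α` and `y = cos β`, `sin θ = sin((α + β)/2) sin((β - α)/2)`. The first factor is
at most `1` and sine is increasing on `[-π/2, π/2]`. -/
theorem two_mul_le_arccos_sub_arccos {θ x y : ℝ} (hθ0 : 0 < θ) (hθ : θ ≤ π / 2)
    (hx : |x| ≤ 1) (hy : |y| ≤ 1) (h : x - y = 2 * sin θ) : 2 * θ ≤ arccos y - arccos x := by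
  rw [abs_le] at hx hy
  rw [← cos_arccos hx.1 hx.2, ← cos_arccos hy.1 hy.2, cos_sub_cos] at h
  have hα := arccos_nonneg x
  have hα' := arccos_le_pi x
  have hβ := arccos_nonneg y
  have hβ' := arccos_le_pi y
  by_contra! hlt
  set α := arccos x
  set β := arccos y
  have h1 : sin ((β - α) / 2) < sin θ :=
    strictMonoOn_sin ⟨by linarith, by linarith⟩ ⟨by linarith, by linarith⟩ (by linarith)
  have h2 : sin ((α - β) / 2) = -sin ((β - α) / 2) := by rw [← sin_neg]; congr 1; ring
  have h3 : 0 ≤ sin ((α + β) / 2) := sin_nonneg_of_nonneg_of_le_pi (by linarith) (by linarith)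
  have h4 := sin_le_one ((α + β) / 2)
  have h5 : 0 < sin θ := sin_pos_of_pos_of_lt_pi hθ0 (by linarith [pi_pos])
  rw [h2] at h
  have h6 : sin ((α + β) / 2) * sin ((β - α) / 2) = sin θ := by linarith
  have h7 : 0 < sin ((α + β) / 2) := h3.lt_of_ne fun h0 => by
    rw [← h0, zero_mul] at h6
    linarith
  nlinarith [mul_lt_mul_of_pos_left h1 h7]

theorem isMinimal_conjExp {p z : A} (hp : IsStarProjection p) (hz : z ∈ horizontalSpace p)
    (hzn : ‖z‖ ≤ π / 2) : IsMinimal (conjExp z p) := by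
  intro a b γ hab hγ hγp ha hb
  rw [curveLength_conjExp hp hz]
  rcases (norm_nonneg z).eq_or_lt with h0 | h0
  · rw [← h0]
    exact intervalIntegral.integral_nonneg hab fun _ _ => norm_nonneg _
  have hγa : γ a = p := ha.trans (isGeodesicJoining_conjExp hp hz).source
  have hγb := hb.trans (isGeodesicJoining_conjExp hp hz).target
  -- A norming functional for the difference of the endpoint symmetries: its two endpoint values
  -- then differ by exactly `2 sin ‖z‖`.
  obtain ⟨ψ, hψ, hψe⟩ := exists_dual_vector'' ℝ ((2 * γ a - 1) - (2 * γ b - 1))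
  have hψ1 : ∀ t ∈ Set.Icc a b, |ψ (2 * γ t - 1)| ≤ 1 := fun t ht => by
    have := ψ.le_of_opNorm_le hψ (2 * γ t - 1)
    rw [one_mul] at this
    exact this.trans (norm_reflection_le (hγp t ht))
  rw [map_sub] at hψe
  have h1 := two_mul_le_arccos_sub_arccos h0 hzn (hψ1 a ⟨le_rfl, hab⟩) (hψ1 b ⟨hab, le_rfl⟩)
    (by rw [hψe, hγa, hγb, norm_reflection_sub_conj hp hz hzn]; rfl)
  linarith [arccos_sub_arccos_le_curveLength hγ hγp hψ]

end Minimality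

end ProjectionManifold

namespace ProjectionManifold

/-! ### The direct rotation between two projections, from a sign operator. -/

section DirectRotation

variable {A : Type*} [CStarAlgebra A]

open Real

theorem mem_horizontalSpace_of_anticommute {p z : A} (hp : IsIdempotentElem p)
    (hzs : star z = -z) (h : (2 * p - 1) * z = -(z * (2 * p - 1))) : z ∈ horizontalSpace p := by
  have h1 : (2 : ℂ) • (p * z + z * p) = (2 : ℂ) • z := by
    rw [two_smul, two_smul]
    have : (2 * p - 1) * z + z * (2 * p - 1) = 0 := by rw [h]; simp
    rw [← sub_eq_zero, ← this]; noncomm_ring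
  have hz : p * z + z * p = z := smul_right_injective A (two_ne_zero' ℂ) h1
  have h2 : p * z * p = 0 := by
    have h3 : p * (p * z + z * p) * p = p * p * z * p + p * z * (p * p) := by noncomm_ring
    rw [hz, hp.eq] at h3
    simpa using h3
  refine ⟨hzs, h2, ?_⟩
  have : (1 - p) * z * (1 - p) = z - (p * z + z * p) + p * z * p := by noncomm_ring
  rw [this, hz, h2, sub_self, zero_add]

theorem hasSum_exp (x : A) : HasSum (fun n : ℕ => ((n.factorial : ℂ)⁻¹) • x ^ n)
    (NormedSpace.exp x) :=
  NormedSpace.exp_series_hasSum_exp' (𝕂 := ℂ) x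

/-- The exponential of a product `y v` where `v` acts on `y` as an involution. -/
theorem exp_mul_of_involutive {y v : A} (hyv : Commute y v) (hv : v * v * y = y) :
    NormedSpace.exp (y * v) = (2⁻¹ : ℂ) • (NormedSpace.exp y + NormedSpace.exp (-y)) +
      (2⁻¹ : ℂ) • (NormedSpace.exp y - NormedSpace.exp (-y)) * v := by
  have h1 := ((hasSum_exp y).add (hasSum_exp (-y))).const_smul (2⁻¹ : ℂ)
  have h2 := (((hasSum_exp y).sub (hasSum_exp (-y))).const_smul (2⁻¹ : ℂ)).mul_right v
  refine (hasSum_exp (y * v)).unique ((h1.add h2).congr_fun ?_)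
  intro n
  have hpow : ∀ k : ℕ, y ^ (k + 1) * (v * v) = y ^ (k + 1) := fun k => by
    rw [pow_succ, mul_assoc, (hyv.mul_right hyv).eq, hv]
  have heven : ∀ k : ℕ, y ^ (2 * k) * v ^ (2 * k) = y ^ (2 * k) := fun k => by
    induction k with
    | zero => simp
    | succ k ih =>
      have : y ^ (2 * (k + 1)) * v ^ (2 * (k + 1)) =
          y ^ 2 * (y ^ (2 * k) * v ^ (2 * k)) * (v * v) := by
        rw [mul_add, pow_add, pow_add v, mul_one, ← sq v, (Commute.refl y).pow_pow (2 * k) 2 |>.eq]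
        noncomm_ring
      rw [this, ih, ← pow_add, show 2 + 2 * k = (2 * k + 1) + 1 by ring, hpow]
      rfl
  rw [hyv.mul_pow]
  rcases Nat.even_or_odd' n with ⟨k, rfl | rfl⟩
  · rw [heven, Even.neg_pow (even_two_mul k), sub_self, smul_zero, zero_mul, add_zero, ← smul_add,
      smul_comm, ← two_smul ℂ, smul_smul (2⁻¹ : ℂ)]
    simp
  · have hodd : y ^ (2 * k + 1) * v ^ (2 * k + 1) = y ^ (2 * k + 1) * v := by
      rw [pow_succ, pow_succ v, mul_assoc, ← mul_assoc y, ← mul_assoc,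
        (hyv.pow_right (2 * k)).eq, ← mul_assoc, heven]
    rw [hodd, Odd.neg_pow (odd_two_mul_add_one k), smul_neg, add_neg_cancel, smul_zero, zero_add,
      sub_neg_eq_add, ← smul_add, smul_comm, ← two_smul ℂ, smul_smul (2⁻¹ : ℂ)]
    simp

/-- From `arccos x = 2 arcsin √((1 - x)/2)`. The cofactor is continuous because `arcsin` is
differentiable at `0`, so whatever kills `√(1 - c)` kills `arccos c`, although `arccos` is not
differentiable at `1`. -/
theorem arccos_eq_sqrt_mul {x : ℝ} (hx : x ∈ Set.Icc (-1 : ℝ) 1) :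
    arccos x = √(1 - x) * (√2 * dslope arcsin 0 (√(1 - x) / √2)) := by
  have hx1 : 0 ≤ 1 - x := by linarith [hx.2]
  have h2 : (√2 : ℝ) ≠ 0 := by positivity
  set y := √(1 - x) / √2 with hy
  have hy2 : y ^ 2 = (1 - x) / 2 := by
    rw [hy, div_pow, sq_sqrt hx1, sq_sqrt zero_le_two]
  have hy0 : 0 ≤ y := by positivity
  have hy1 : y ≤ 1 := by nlinarith [hx.1]
  have h : arccos x = 2 * arcsin y := by
    refine arccos_eq_of_eq_cos (by linarith [arcsin_nonneg.2 hy0])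
      (by linarith [arcsin_le_pi_div_two y]) ?_
    rw [cos_two_mul, cos_arcsin, sq_sqrt (by nlinarith), hy2]; ring
  have h3 := sub_smul_dslope arcsin 0 y
  rw [arcsin_zero, sub_zero, sub_zero, smul_eq_mul] at h3
  have h4 : √(1 - x) = √2 * y := by rw [hy]; field_simp
  rw [h, ← h3, h4]
  linear_combination (-(y * dslope arcsin 0 y)) * (sq_sqrt (zero_le_two (α := ℝ)))

theorem continuous_dslope_arcsin : Continuous (dslope arcsin 0) := by
  rw [continuous_iff_continuousAt]
  intro x
  rcases eq_or_ne x 0 with rfl | hx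
  · exact continuousAt_dslope_same.2 (differentiableAt_arcsin.2 (by norm_num))
  · exact (continuousAt_dslope_of_ne hx).2 continuous_arcsin.continuousAt

theorem mem_Icc_of_mem_spectrum {c : A} (hc1 : ‖c‖ ≤ 1) {x : ℝ} (hx : x ∈ spectrum ℝ c) :
    x ∈ Set.Icc (-1 : ℝ) 1 := by
  rw [Set.mem_Icc, ← abs_le]
  cases subsingleton_or_nontrivial A
  · simp at hx
  exact (spectrum.norm_le_norm_of_mem hx).trans hc1

theorem mul_cfc_arccos_eq_zero {c y : A} (hc : IsSelfAdjoint c) (hc1 : ‖c‖ ≤ 1)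
    (h : y * (1 - c) = 0) : y * cfc arccos c = 0 := by
  have h1 : cfc (fun x : ℝ => √(1 - x)) c * cfc (fun x : ℝ => √(1 - x)) c = 1 - c := by
    rw [← cfc_mul _ _ c]
    have : (spectrum ℝ c).EqOn (fun x => √(1 - x) * √(1 - x)) (fun x => 1 - x) := fun x hx =>
      mul_self_sqrt (by linarith [(mem_Icc_of_mem_spectrum hc1 hx).2])
    rw [cfc_congr this, cfc_sub _ _ c, cfc_const_one ℝ c, cfc_id' ℝ c]
  have h2 : y * cfc (fun x : ℝ => √(1 - x)) c = 0 := by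
    have hsa : IsSelfAdjoint (cfc (fun x : ℝ => √(1 - x)) c) := cfc_predicate _ c
    rw [← CStarRing.mul_star_self_eq_zero_iff, star_mul, hsa.star_eq, mul_assoc,
      ← mul_assoc _ _ (star y), h1, ← mul_assoc, h, zero_mul]
  have h3 : cfc arccos c = cfc (fun x : ℝ => √(1 - x)) c *
      cfc (fun x : ℝ => √2 * dslope arcsin 0 (√(1 - x) / √2)) c := by
    have hcont : Continuous fun x : ℝ => √2 * dslope arcsin 0 (√(1 - x) / √2) :=
      continuous_const.mul (continuous_dslope_arcsin.comp (by fun_prop))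
    rw [← cfc_mul _ _ c (by fun_prop) hcont.continuousOn]
    exact cfc_congr fun x hx => arccos_eq_sqrt_mul (mem_Icc_of_mem_spectrum hc1 hx)
  rw [h3, ← mul_assoc, h2, zero_mul]

theorem exp_I_smul_cfc_arccos {c : A} (hc : IsSelfAdjoint c) (hc1 : ‖c‖ ≤ 1) :
    NormedSpace.exp (Complex.I • cfc arccos c) =
      c + Complex.I • cfc (fun x : ℝ => √(1 - x ^ 2)) c := by
  have hre : ∀ f : ℝ → ℝ, Continuous f → Continuous fun x : ℂ => ((f x.re : ℝ) : ℂ) :=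
    fun f hf => Complex.continuous_ofReal.comp (hf.comp Complex.continuous_re)
  have hk1 := hre _ continuous_arccos
  have hk2 := hre (fun x : ℝ => √(1 - x ^ 2)) (by fun_prop)
  have h1 : Complex.I • cfc arccos c = cfc (fun x : ℂ => Complex.I * (arccos x.re : ℂ)) c := by
    rw [cfc_real_eq_complex, ← cfc_const_mul _ _ _ hk1.continuousOn]
  have hn : IsStarNormal (cfc (fun x : ℂ => Complex.I * (arccos x.re : ℂ)) c) := cfc_predicate _ c
  rw [h1, ← CFC.complex_exp_eq_normedSpace_exp,
    ← cfc_comp' Complex.exp (fun x : ℂ => Complex.I * (arccos x.re : ℂ)) c (by fun_prop)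
    (by fun_prop)]
  have h2 : (spectrum ℂ c).EqOn (fun x => Complex.exp (Complex.I * (arccos x.re : ℂ)))
      (fun x => x + Complex.I * ((√(1 - x.re ^ 2) : ℝ) : ℂ)) := fun x hx => by
    have hxr : x = x.re := hc.mem_spectrum_eq_re hx
    have hx1 : x.re ∈ Set.Icc (-1 : ℝ) 1 := by
      cases subsingleton_or_nontrivial A
      · simp at hx
      rw [Set.mem_Icc, ← abs_le]
      exact (Complex.abs_re_le_norm x).trans ((spectrum.norm_le_norm_of_mem hx).trans hc1)
    simp only
    rw [mul_comm, Complex.exp_mul_I, ← Complex.ofReal_cos, ← Complex.ofReal_sin,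
      cos_arccos hx1.1 hx1.2, sin_arccos, ← hxr, mul_comm]
  rw [cfc_congr h2,
    cfc_add c (fun x : ℂ => x) (fun x : ℂ => Complex.I * ((√(1 - x.re ^ 2) : ℝ) : ℂ))
    (by fun_prop) (by fun_prop),
    cfc_id' ℂ c, cfc_const_mul _ _ _ hk2.continuousOn, cfc_real_eq_complex]

/-- The cosine of twice the angle operator of a pair of projections. -/
noncomputable def cosTwoAngle (p q : A) : A :=
  (2⁻¹ : ℂ) • ((2 * q - 1) * (2 * p - 1) + (2 * p - 1) * (2 * q - 1))

/-- The skew part of the product of the reflections of a pair of projections. -/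
noncomputable def skewPart (p q : A) : A :=
  (2⁻¹ : ℂ) • ((2 * q - 1) * (2 * p - 1) - (2 * p - 1) * (2 * q - 1))

theorem isSelfAdjoint_cosTwoAngle {p q : A} (hp : IsStarProjection p) (hq : IsStarProjection q) :
    IsSelfAdjoint (cosTwoAngle p q) := by
  rw [isSelfAdjoint_iff, cosTwoAngle, star_smul, star_add, star_mul, star_mul,
    (isSelfAdjoint_reflection hp.isSelfAdjoint).star_eq,
    (isSelfAdjoint_reflection hq.isSelfAdjoint).star_eq, add_comm]
  simp

theorem norm_cosTwoAngle_le {p q : A} (hp : IsStarProjection p) (hq : IsStarProjection q) :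
    ‖cosTwoAngle p q‖ ≤ 1 := by
  have h1 := norm_reflection_le hp
  have h2 := norm_reflection_le hq
  have h3 : ∀ x y : A, ‖x‖ ≤ 1 → ‖y‖ ≤ 1 → ‖x * y‖ ≤ 1 := fun x y hx hy =>
    (norm_mul_le _ _).trans (mul_le_one₀ hx (norm_nonneg _) hy)
  rw [cosTwoAngle, norm_smul]
  have := (norm_add_le _ _).trans (add_le_add (h3 _ _ h2 h1) (h3 _ _ h1 h2))
  simp only [norm_inv, Complex.norm_ofNat]
  linarith

theorem commute_reflection_cosTwoAngle {p q : A} (hp : IsStarProjection p) :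
    Commute (2 * p - 1) (cosTwoAngle p q) := by
  have h := reflection_mul_self hp.isIdempotentElem
  refine Commute.smul_right ?_ _
  rw [commute_iff_eq, mul_add, add_mul, ← mul_assoc _ (2 * p - 1) (2 * q - 1), h,
    mul_assoc (2 * q - 1) (2 * p - 1) (2 * p - 1), h, one_mul, mul_one, mul_assoc, add_comm]

/-- A selfadjoint `v` which anticommutes with the reflection of `p` and plays the role of the sign
of the skew part yields a short geodesic between `p` and `q`. -/
theorem exists_horizontal_of_sign {p q v : A} (hp : IsStarProjection p) (hq : IsStarProjection q)
    (hv : IsSelfAdjoint v) (hvp : (2 * p - 1) * v = -(v * (2 * p - 1)))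
    (hvc : Commute v (cosTwoAngle p q))
    (hvv : (1 - v * v) * (1 - cosTwoAngle p q) = 0)
    (hvd : Complex.I • (v * cfc (fun x : ℝ => √(1 - x ^ 2)) (cosTwoAngle p q)) = skewPart p q) :
    ∃ z ∈ horizontalSpace p, ‖z‖ ≤ π / 2 ∧
      NormedSpace.exp z * p * NormedSpace.exp (-z) = q := by
  set c := cosTwoAngle p q with hc_def
  have hc : IsSelfAdjoint c := isSelfAdjoint_cosTwoAngle hp hq
  have hc1 : ‖c‖ ≤ 1 := norm_cosTwoAngle_le hp hq
  set b := cfc arccos c with hb_def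
  set m := cfc (fun x : ℝ => √(1 - x ^ 2)) c with hm_def
  have hb : IsSelfAdjoint b := cfc_predicate _ c
  have hm : IsSelfAdjoint m := cfc_predicate _ c
  have hbv : Commute b v := (hvc.symm.cfc_real arccos)
  have hmv : Commute m v := (hvc.symm.cfc_real _)
  have hbs : Commute b (2 * p - 1) := ((commute_reflection_cosTwoAngle hp).symm.cfc_real arccos)
  have hvvb : v * v * b = b := by
    have := mul_cfc_arccos_eq_zero hc hc1 hvv
    rw [sub_mul, one_mul, sub_eq_zero] at this
    exact this.symm
  have hbn : ‖b‖ ≤ π := norm_cfc_le pi_nonneg fun x _ => by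
    rw [Real.norm_of_nonneg (arccos_nonneg x)]; exact arccos_le_pi x
  have ha : IsSelfAdjoint (b * v) := (IsSelfAdjoint.commute_iff hb hv).1 hbv
  have han : ‖b * v‖ ≤ π := by
    refine abs_le_of_sq_le_sq' ?_ pi_nonneg |>.2
    rw [sq, ← CStarRing.norm_star_mul_self, ha.star_eq]
    have : b * v * (b * v) = b * b := by
      calc b * v * (b * v) = b * (v * (v * b)) := by rw [mul_assoc, hbv.eq]
        _ = b * b := by rw [← mul_assoc v, hvvb]
    rw [this, sq]
    exact (norm_mul_le _ _).trans (by gcongr)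
  -- Half of a logarithm of the product of the symmetries: `b` is twice the angle, of norm at most
  -- `π`, and `v` carries its sign.
  set z := (Complex.I / 2) • (b * v) with hz_def
  have hz : z ∈ horizontalSpace p := by
    refine mem_horizontalSpace_of_anticommute hp.isIdempotentElem ?_ ?_
    · rw [hz_def, star_smul, ha.star_eq, ← neg_smul]
      congr 1
      simp [neg_div]
    · rw [hz_def, mul_smul_comm, smul_mul_assoc, ← smul_neg, ← mul_assoc, ← hbs.eq, mul_assoc,
        hvp, mul_neg, ← mul_assoc]
  refine ⟨z, hz, ?_, ?_⟩
  · rw [hz_def, norm_smul]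
    simp only [norm_div, Complex.norm_I, Complex.norm_ofNat]
    linarith
  · have h1 : (2 : ℕ) • z = (Complex.I • b) * v := by
      rw [hz_def, two_smul, ← add_smul, smul_mul_assoc]
      congr 1; ring
    have hE := exp_I_smul_cfc_arccos hc hc1
    rw [← hb_def, ← hm_def] at hE
    have hE' : NormedSpace.exp (-(Complex.I • b)) = c - Complex.I • m := by
      rw [← star_exp_of_skew (z := Complex.I • b) (by simp [star_smul, hb.star_eq]), hE]
      simp [star_smul, hm.star_eq, hc.star_eq, sub_eq_add_neg]
    -- Since `v² b = b`, the even part of `e^{ibv}` is `cos b = c` and the odd part is `i (sin b) v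
    -- = i m v`, which is the skew part.
    have h2 : NormedSpace.exp ((2 : ℕ) • z) = (2 * q - 1) * (2 * p - 1) := by
      rw [h1, exp_mul_of_involutive (hbv.smul_left _) (by rw [mul_smul_comm, hvvb]), hE, hE']
      have e1 : (2⁻¹ : ℂ) • (c + Complex.I • m + (c - Complex.I • m)) = c := by
        rw [add_add_sub_cancel, ← two_smul ℂ, smul_smul]; simp
      have e2 : (2⁻¹ : ℂ) • (c + Complex.I • m - (c - Complex.I • m)) = Complex.I • m := by
        rw [add_sub_sub_cancel, ← two_smul ℂ, smul_smul (2⁻¹ : ℂ)]; simp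
      rw [e1, e2, smul_mul_assoc, hmv.eq, hvd, hc_def, cosTwoAngle, skewPart, ← smul_add,
        add_add_sub_cancel, ← two_smul ℂ, smul_smul]
      simp
    have h3 := reflection_conj_exp hz
    rw [h2, mul_assoc (2 * q - 1), reflection_mul_self hp.isIdempotentElem, mul_one,
      sub_left_inj] at h3
    have h4 : (2 : ℂ) • (NormedSpace.exp z * p * NormedSpace.exp (-z)) = (2 : ℂ) • q := by
      rw [two_smul, two_smul, ← two_mul, ← two_mul, h3]
    simpa using h4

end DirectRotation

end ProjectionManifold

/-! ### Positive and negative parts of selfadjoint elements. -/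

section PosNegParts

variable {A : Type*} [CStarAlgebra A]

/-- The positive part of a selfadjoint element, by continuous functional calculus. -/
noncomputable def positivePart (d : A) : A := cfc (fun x : ℝ => max x 0) d

/-- The negative part of a selfadjoint element, by continuous functional calculus. -/
noncomputable def negativePart (d : A) : A := cfc (fun x : ℝ => max (-x) 0) d

theorem isSelfAdjoint_positivePart (d : A) : IsSelfAdjoint (positivePart d) := cfc_predicate _ d

theorem isSelfAdjoint_negativePart (d : A) : IsSelfAdjoint (negativePart d) := cfc_predicate _ d

theorem positivePart_sub_negativePart {d : A} (hd : IsSelfAdjoint d) :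
    positivePart d - negativePart d = d := by
  rw [positivePart, negativePart, ← cfc_sub _ _ d]
  conv_rhs => rw [← cfc_id' ℝ d]
  refine cfc_congr fun x _ => ?_
  rcases le_total x 0 with h | h <;> simp [h]

theorem positivePart_add_negativePart {d : A} (hd : IsSelfAdjoint d) :
    positivePart d + negativePart d = cfc Real.sqrt (d * d) := by
  have h1 : d * d = cfc (fun x : ℝ => x * x) d := by
    rw [cfc_mul (fun x : ℝ => x) (fun x : ℝ => x) d, cfc_id' ℝ d]
  rw [positivePart, negativePart,
    ← cfc_add d (fun x : ℝ => max x 0) (fun x : ℝ => max (-x) 0), h1, ← cfc_comp' Real.sqrt _ d]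
  refine cfc_congr fun x _ => ?_
  simp only [Real.sqrt_mul_self_eq_abs]
  rcases le_total x 0 with h | h <;> simp [h, abs_of_nonneg, abs_of_nonpos]

theorem positivePart_mul_negativePart (d : A) : positivePart d * negativePart d = 0 := by
  rw [positivePart, negativePart, ← cfc_mul _ _ d]
  have : (fun x : ℝ => max x 0 * max (-x) 0) = fun _ => 0 := by
    ext x
    rcases le_total x 0 with h | h <;> simp [h]
  rw [this, cfc_const_zero]

theorem negativePart_mul_positivePart (d : A) : negativePart d * positivePart d = 0 := by
  have := congrArg star (positivePart_mul_negativePart d)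
  rwa [star_mul, star_zero, (isSelfAdjoint_positivePart d).star_eq,
    (isSelfAdjoint_negativePart d).star_eq] at this

/-- By `d₊ d = d₊²`, one gets `(d₊ e)* (d₊ e) = e* d₊ d e = 0`. -/
theorem positivePart_mul_eq_zero {d e : A} (hd : IsSelfAdjoint d) (h : d * e = 0) :
    positivePart d * e = 0 := by
  have h1 : positivePart d * d = positivePart d * positivePart d := by
    conv_lhs => rw [← positivePart_sub_negativePart hd, mul_sub]
    rw [positivePart_sub_negativePart hd, positivePart_mul_negativePart, sub_zero]
  rw [← CStarRing.star_mul_self_eq_zero_iff, star_mul, (isSelfAdjoint_positivePart d).star_eq,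
    mul_assoc, ← mul_assoc (positivePart d), ← h1, mul_assoc, h, mul_zero, mul_zero]

theorem negativePart_mul_eq_zero {d e : A} (hd : IsSelfAdjoint d) (h : d * e = 0) :
    negativePart d * e = 0 := by
  have h1 : negativePart d = positivePart d - d := by
    rw [eq_sub_iff_add_eq, ← eq_sub_iff_add_eq', positivePart_sub_negativePart hd]
  rw [h1, sub_mul, positivePart_mul_eq_zero hd h, h, sub_zero]

theorem Commute.positivePart {b d : A} (h : Commute d b) : Commute (positivePart d) b :=
  h.cfc_real _

theorem Commute.negativePart {b d : A} (h : Commute d b) : Commute (negativePart d) b :=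
  h.cfc_real _

/-- Conjugation by the symmetry `s` is an automorphism sending `d` to `-d`, and it commutes with
functional calculus. -/
theorem semiconjBy_positivePart_negativePart {s d : A} (hs : IsSelfAdjoint s) (hss : s * s = 1)
    (hd : IsSelfAdjoint d) (h : s * d = -(d * s)) :
    SemiconjBy s (positivePart d) (negativePart d) := by
  have hu : s ∈ unitary A := by rw [Unitary.mem_iff, hs.star_eq]; exact ⟨hss, hss⟩
  let φ := Unitary.conjStarAlgAut ℂ A ⟨s, hu⟩
  have hφ : ∀ x, φ x = s * x * s := fun x => by
    rw [Unitary.conjStarAlgAut_apply]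
    simp [hs.star_eq]
  have hφd : φ d = -d := by rw [hφ, h, neg_mul, mul_assoc, hss, mul_one]
  have hcont : Continuous φ := by
    have : (φ : A → A) = fun x => s * x * s := funext hφ
    rw [this]; fun_prop
  have h1 : φ (positivePart d) = negativePart d := by
    rw [positivePart, StarAlgHomClass.map_cfc φ (fun x : ℝ => max x 0) d (by fun_prop) hcont hd
      (by rw [hφd]; exact hd.neg), hφd, negativePart]
    exact (cfc_comp_neg (fun x : ℝ => max x 0) d).symm
  rw [SemiconjBy, ← h1, hφ, mul_assoc _ s s, hss, mul_one]

theorem StarAlgHom.map_positivePart {B : Type*} [CStarAlgebra B] (φ : A →⋆ₐ[ℂ] B)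
    (hφ : Continuous φ) {d : A} (hd : IsSelfAdjoint d) :
    φ (positivePart d) = positivePart (φ d) :=
  StarAlgHom.map_cfc φ _ d (by fun_prop) hφ hd (hd.map φ)

theorem StarAlgHom.map_negativePart {B : Type*} [CStarAlgebra B] (φ : A →⋆ₐ[ℂ] B)
    (hφ : Continuous φ) {d : A} (hd : IsSelfAdjoint d) :
    φ (negativePart d) = negativePart (φ d) :=
  StarAlgHom.map_cfc φ _ d (by fun_prop) hφ hd (hd.map φ)

theorem StarAlgHom.exists_isSelfAdjoint_lift {B : Type*} [CStarAlgebra B] (φ : A →⋆ₐ[ℂ] B)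
    (hφ : Function.Surjective φ) {s : B} (hs : IsSelfAdjoint s) :
    ∃ T : A, IsSelfAdjoint T ∧ φ T = s := by
  obtain ⟨R, rfl⟩ := hφ s
  refine ⟨(2⁻¹ : ℂ) • (R + star R), ?_, ?_⟩
  · rw [isSelfAdjoint_iff, star_smul, star_add, star_star, add_comm]
    simp
  · rw [map_smul, map_add, map_star, hs.star_eq, ← two_smul ℂ, smul_smul]
    simp

/-- The symmetry squares to `1`, so its absolute value is `1` and its positive part is half of its
sum with `1`. -/
theorem positivePart_reflection {p : A} (hp : IsStarProjection p) :
    positivePart (2 * p - 1) = p := by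
  have hs := ProjectionManifold.isSelfAdjoint_reflection hp.isSelfAdjoint
  have h1 := positivePart_sub_negativePart hs
  have h2 := positivePart_add_negativePart hs
  rw [ProjectionManifold.reflection_mul_self hp.isIdempotentElem, cfc_apply_one] at h2
  simp only [Real.sqrt_one, map_one] at h2
  refine smul_right_injective A (two_ne_zero' ℂ) ?_
  simp only [two_smul]
  calc _ = (positivePart (2 * p - 1) - negativePart (2 * p - 1)) +
        (positivePart (2 * p - 1) + negativePart (2 * p - 1)) := by abel
    _ = p + p := by rw [h1, h2]; noncomm_ring

theorem negativePart_reflection {p : A} (hp : IsStarProjection p) :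
    negativePart (2 * p - 1) = 1 - p := by
  have hs := ProjectionManifold.isSelfAdjoint_reflection hp.isSelfAdjoint
  have h1 := positivePart_sub_negativePart hs
  rw [positivePart_reflection hp] at h1
  rw [← sub_sub_cancel p (negativePart _), h1]; noncomm_ring

end PosNegParts

theorem isCompactOperator_starProjection {H : Type*} [NormedAddCommGroup H]
    [InnerProductSpace ℂ H] (U : Submodule ℂ H) [FiniteDimensional ℂ U] :
    IsCompactOperator U.starProjection := by
  have : ProperSpace U := FiniteDimensional.proper ℂ U
  have h1 : IsCompactOperator (U.orthogonalProjectionOnto : H →L[ℂ] U) :=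
    isCompactOperator_of_locallyCompactSpace_dom U.orthogonalProjectionOnto
  exact IsCompactOperator.continuous_comp h1 (g := ((↑) : U → H)) continuous_subtype_val

/-! ### Projections onto null spaces. -/

section KernelProjections

variable {H : Type*} [NormedAddCommGroup H] [InnerProductSpace ℂ H] [CompleteSpace H]

/-- The orthogonal projection onto the null space of an operator. -/
noncomputable def kerProj (X : H →L[ℂ] H) : H →L[ℂ] H := X.ker.starProjection

theorem isStarProjection_kerProj (X : H →L[ℂ] H) : IsStarProjection (kerProj X) :=
  isStarProjection_starProjection

theorem star_kerProj (X : H →L[ℂ] H) : star (kerProj X) = kerProj X :=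
  (isStarProjection_kerProj X).isSelfAdjoint.star_eq

theorem mul_kerProj (X : H →L[ℂ] H) : X * kerProj X = 0 := by
  ext x
  exact X.ker.starProjection_apply_mem x

theorem kerProj_mul_of_mul_eq_zero {X Y : H →L[ℂ] H} (h : X * Y = 0) : kerProj X * Y = Y := by
  ext x
  exact Submodule.starProjection_eq_self_iff.2 (by
    simpa using congrArg (fun Z : H →L[ℂ] H => Z x) h)

theorem mul_kerProj_of_mul_eq_zero {X Y : H →L[ℂ] H} (hX : IsSelfAdjoint X) (h : Y * X = 0) :
    Y * kerProj X = Y := by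
  have h1 : X * star Y = 0 := by
    have := congrArg star h
    rwa [star_mul, hX.star_eq, star_zero] at this
  have := congrArg star (kerProj_mul_of_mul_eq_zero h1)
  rwa [star_mul, star_star, star_kerProj] at this

theorem kerProj_mul {X : H →L[ℂ] H} (hX : IsSelfAdjoint X) : kerProj X * X = 0 := by
  have := congrArg star (mul_kerProj X)
  rwa [star_mul, hX.star_eq, star_kerProj, star_zero] at this

/-- `B` maps `ker X` into `ker Y`, and by selfadjointness `B*` maps `ker Y` into `ker X`; together
these give the intertwining. -/
theorem SemiconjBy.kerProj {B X Y : H →L[ℂ] H} (hX : IsSelfAdjoint X) (hY : IsSelfAdjoint Y)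
    (h : SemiconjBy B X Y) : SemiconjBy B (kerProj X) (kerProj Y) := by
  have h' : X * star B = star B * Y := by
    have := congrArg star h.eq
    rwa [star_mul, star_mul, hX.star_eq, hY.star_eq] at this
  have h1 : _root_.kerProj Y * (B * _root_.kerProj X) = B * _root_.kerProj X :=
    kerProj_mul_of_mul_eq_zero (by rw [← mul_assoc, ← h.eq, mul_assoc, mul_kerProj, mul_zero])
  have h2 : _root_.kerProj X * (star B * _root_.kerProj Y) = star B * _root_.kerProj Y :=
    kerProj_mul_of_mul_eq_zero (by rw [← mul_assoc, h', mul_assoc, mul_kerProj, mul_zero])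
  have h3 := congrArg star h2
  simp only [star_mul, star_star, star_kerProj] at h3
  rw [SemiconjBy, ← h3, ← h1, mul_assoc]

theorem Commute.kerProj {B X : H →L[ℂ] H} (hX : IsSelfAdjoint X) (h : Commute X B) :
    Commute (kerProj X) B :=
  Commute.symm (SemiconjBy.kerProj hX hX h.symm)

end KernelProjections

/-! ### Lifting projections from the Calkin algebra. -/

section LiftingProjections

variable {H : Type*} [NormedAddCommGroup H] [InnerProductSpace ℂ H] [CompleteSpace H]

theorem Calkin.continuous_π : Continuous (Calkin.π : (H →L[ℂ] H) →⋆ₐ[ℂ] Calkin H) :=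
  AddMonoidHomClass.continuous_of_bound Calkin.π 1 fun T => by
    rw [one_mul]; exact Calkin.norm_mkAlg_le T

theorem Calkin.π_surjective : Function.Surjective (Calkin.π : (H →L[ℂ] H) →⋆ₐ[ℂ] Calkin H) :=
  Calkin.mkAlg_surjective

theorem Calkin.π_eq_zero_of_isCompactOperator {T : H →L[ℂ] H} (hT : IsCompactOperator T) :
    Calkin.π T = 0 := by
  rw [← map_zero Calkin.π, Calkin.π_eq_iff, sub_zero]
  exact hT

/-- Every projection of the Calkin algebra lifts to an orthogonal projection. -/
theorem Calkin.exists_isStarProjection_lift {p : Calkin H} (hp : IsStarProjection p) :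
    ∃ P : H →L[ℂ] H, IsStarProjection P ∧ Calkin.π P = p := by
  obtain ⟨T, hTs, hπT⟩ := StarAlgHom.exists_isSelfAdjoint_lift Calkin.π
    (Calkin.π_surjective (H := H)) (ProjectionManifold.isSelfAdjoint_reflection hp.isSelfAdjoint)
  have hpos : Calkin.π (positivePart T) = p := by
    rw [StarAlgHom.map_positivePart _ (Calkin.continuous_π (H := H)) hTs, hπT,
      positivePart_reflection hp]
  have hneg : Calkin.π (negativePart T) = 1 - p := by
    rw [StarAlgHom.map_negativePart _ (Calkin.continuous_π (H := H)) hTs, hπT,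
      negativePart_reflection hp]
  -- This projection fixes `T₊` and kills `T₋`, which lift `p` and `1 - p`; its image is therefore
  -- `p`, whatever happens on `ker T`.
  refine ⟨kerProj (negativePart T), isStarProjection_kerProj _, ?_⟩
  set P := kerProj (negativePart T)
  have h1 : Calkin.π P * p = p := by
    rw [← hpos, ← map_mul, kerProj_mul_of_mul_eq_zero (negativePart_mul_positivePart T)]
  have h2 : Calkin.π P * (1 - p) = 0 := by
    rw [← hneg, ← map_mul, kerProj_mul (isSelfAdjoint_negativePart T), map_zero]
  rw [mul_sub, mul_one, h1, sub_eq_zero] at h2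
  exact h2

end LiftingProjections

theorem reflection_apply_eq_self_iff {H : Type*} [NormedAddCommGroup H]
    [InnerProductSpace ℂ H] {P : H →L[ℂ] H} {x : H} :
    (2 * P - 1) x = (1 : ℂ) • x ↔ P x = x := by
  have h : (2 * P - 1) x = (2 : ℂ) • P x - x := by
    rw [two_mul, two_smul]; rfl
  rw [h, one_smul, sub_eq_iff_eq_add, ← two_smul ℂ x]
  exact (smul_right_injective H (two_ne_zero' ℂ)).eq_iff

theorem reflection_apply_eq_neg_iff {H : Type*} [NormedAddCommGroup H]
    [InnerProductSpace ℂ H] {P : H →L[ℂ] H} {x : H} :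
    (2 * P - 1) x = -(1 : ℂ) • x ↔ P x = 0 := by
  have h : (2 * P - 1) x = (2 : ℂ) • P x - x := by
    rw [two_mul, two_smul]; rfl
  rw [h, neg_smul, one_smul, sub_eq_neg_self]
  simp

/-! ### From a geodesic to lifts with balanced exceptional subspaces. -/

section GeodesicLifts

variable {H : Type*} [NormedAddCommGroup H] [InnerProductSpace ℂ H] [CompleteSpace H]

open ProjectionManifold

theorem mem_ker_sub_sub_one_iff {P Q : H →L[ℂ] H} (hP : IsStarProjection P)
    (hQ : IsStarProjection Q) {x : H} : x ∈ (P - Q - 1).ker ↔ P x = x ∧ Q x = 0 := by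
  have h0 : x ∈ (P - Q - 1).ker ↔ P x - Q x - x = 0 := by
    simp [LinearMap.mem_ker]
  rw [h0]
  constructor
  · intro h
    have hPP : ∀ y, P (P y) = P y := fun y =>
      congrArg (fun T : H →L[ℂ] H => T y) hP.isIdempotentElem.eq
    have hQQ : ∀ y, Q (Q y) = Q y := fun y =>
      congrArg (fun T : H →L[ℂ] H => T y) hQ.isIdempotentElem.eq
    -- Applying `P` to `P x = x + Q x` gives `P Q x = 0`; pairing the same identity with `Q x` then
    -- gives `2 ‖Q x‖² = 0`.
    have hPQ : P (Q x) = 0 := by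
      have := congrArg P h
      simpa [hPP] using this
    have hin : inner ℂ (Q x) (Q x) = 0 := by
      have h1 : P x = x + Q x := by rw [sub_sub, sub_eq_zero] at h; rw [h, add_comm]
      have hPs : ∀ y z, inner ℂ (P y) z = inner ℂ y (P z) := fun y z => by
        rw [← ContinuousLinearMap.adjoint_inner_right, ← ContinuousLinearMap.star_eq_adjoint,
          hP.isSelfAdjoint.star_eq]
      have hQs : ∀ y z, inner ℂ (Q y) z = inner ℂ y (Q z) := fun y z => by
        rw [← ContinuousLinearMap.adjoint_inner_right, ← ContinuousLinearMap.star_eq_adjoint,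
          hQ.isSelfAdjoint.star_eq]
      have h2 : inner ℂ (P x) (Q x) = 0 := by rw [hPs, hPQ, inner_zero_right]
      have h3 : inner ℂ x (Q x) = inner ℂ (Q x) (Q x) := by rw [hQs, hQQ]
      rw [h1, inner_add_left, h3, ← two_mul] at h2
      simpa using h2
    have hQx : Q x = 0 := inner_self_eq_zero.1 hin
    refine ⟨?_, hQx⟩
    rwa [hQx, sub_zero, sub_eq_zero] at h
  · rintro ⟨h1, h2⟩
    rw [h1, h2]; simp

theorem mem_ker_sub_add_one_iff {P Q : H →L[ℂ] H} (hP : IsStarProjection P)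
    (hQ : IsStarProjection Q) {x : H} : x ∈ (P - Q + 1).ker ↔ P x = 0 ∧ Q x = x := by
  rw [and_comm, ← mem_ker_sub_sub_one_iff hQ hP]
  have : P - Q + 1 = -(Q - P - 1) := by abel
  rw [this]
  simp [LinearMap.mem_ker, -neg_sub, -neg_add_rev]

theorem exp_apply_of_apply_eq_zero {W : H →L[ℂ] H} {x : H} (h : W x = 0) :
    NormedSpace.exp W x = x := by
  have h1 : (kerProj W) x = x := Submodule.starProjection_eq_self_iff.2 h
  let +nondep : NormedAlgebra ℚ (H →L[ℂ] H) := .restrictScalars ℚ ℂ _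
  have h2 : SemiconjBy (kerProj W) 0 W := by rw [SemiconjBy, mul_zero, mul_kerProj]
  have h3 := congrArg (fun T : H →L[ℂ] H => T x) h2.exp_right.eq
  simp only [NormedSpace.exp_zero, mul_one, mul_apply_eq_comp, h1] at h3
  exact h3.symm

/-- A horizontal operator interchanges the two exceptional subspaces of the projections which its
exponential joins. -/
theorem reflection_apply_of_horizontal {P Z : H →L[ℂ] H} (hZ : Z ∈ horizontalSpace P) {c : ℂ}
    (hc : c ≠ 0) {x : H} (h1 : (2 * P - 1) x = c • x)
    (h2 : (2 * (NormedSpace.exp Z * P * NormedSpace.exp (-Z)) - 1) x = -c • x) :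
    (2 * P - 1) (Z x) = -c • Z x ∧
      (2 * (NormedSpace.exp Z * P * NormedSpace.exp (-Z)) - 1) (Z x) = c • Z x ∧
      (Z x = 0 → x = 0) := by
  rw [reflection_conj_exp hZ, mul_apply_eq_comp] at h2 ⊢
  rw [h1, map_smul, neg_smul, ← smul_neg] at h2
  -- The product of the symmetries is `-1` on such vectors. This passes to `Z x`, which commutes
  -- past the exponential, and it excludes `Z x = 0`, where the exponential would fix `x`.
  have h3 : NormedSpace.exp (2 • Z) x = -x := smul_right_injective H hc h2
  have h4 : (2 * P - 1) (Z x) = -c • Z x := by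
    have := congrArg (fun T : H →L[ℂ] H => T x) (reflection_anticommute hZ)
    simp only [mul_apply_eq_comp, neg_apply, h1, map_smul] at this
    rw [this, neg_smul]
  refine ⟨h4, ?_, fun h0 => ?_⟩
  · let +nondep : NormedAlgebra ℚ (H →L[ℂ] H) := .restrictScalars ℚ ℂ _
    have h5 : Commute (NormedSpace.exp (2 • Z)) Z := ((Commute.refl Z).smul_left 2).exp_left
    have h6 := congrArg (fun T : H →L[ℂ] H => T x) h5.eq
    simp only [mul_apply_eq_comp, h3, map_neg] at h6
    rw [h4, map_smul, h6, smul_neg, neg_smul, neg_neg]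
  · have h7 : NormedSpace.exp (2 • Z) x = x := exp_apply_of_apply_eq_zero (by simp [h0])
    rw [h3] at h7
    have h8 : (2 : ℂ) • x = 0 := by
      rw [two_smul]
      nth_rw 1 [← h7]
      exact neg_add_cancel x
    exact (smul_eq_zero.1 h8).resolve_left two_ne_zero

theorem finiteDimensional_ker_iff_of_horizontal {P Z : H →L[ℂ] H} (hP : IsStarProjection P)
    (hZ : Z ∈ horizontalSpace P) :
    FiniteDimensional ℂ (P - NormedSpace.exp Z * P * NormedSpace.exp (-Z) - 1).ker ↔
      FiniteDimensional ℂ (P - NormedSpace.exp Z * P * NormedSpace.exp (-Z) + 1).ker := by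
  have hQ : IsStarProjection (NormedSpace.exp Z * P * NormedSpace.exp (-Z)) := by
    simpa [conjExp] using isStarProjection_conjExp hZ.1 hP 1
  have key : ∀ K L : Submodule ℂ H, (∀ x ∈ K, Z x ∈ L ∧ (Z x = 0 → x = 0)) →
      FiniteDimensional ℂ L → FiniteDimensional ℂ K := fun K L h hL => by
    let f : K →ₗ[ℂ] L := (Z : H →ₗ[ℂ] H).restrict fun x hx => (h x hx).1
    refine FiniteDimensional.of_injective f ((injective_iff_map_eq_zero f).2 fun x hx => ?_)
    exact Subtype.ext ((h x x.2).2 (congrArg Subtype.val hx))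
  constructor
  · refine key _ _ fun x hx => ?_
    rw [mem_ker_sub_add_one_iff hP hQ] at hx
    rw [mem_ker_sub_sub_one_iff hP hQ]
    have := reflection_apply_of_horizontal hZ (c := -1) (by simp)
      (reflection_apply_eq_neg_iff.2 hx.1)
      (by rw [neg_neg]; exact reflection_apply_eq_self_iff.2 hx.2)
    rw [neg_neg, reflection_apply_eq_self_iff, reflection_apply_eq_neg_iff] at this
    exact ⟨⟨this.1, this.2.1⟩, this.2.2⟩
  · refine key _ _ fun x hx => ?_
    rw [mem_ker_sub_sub_one_iff hP hQ] at hx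
    rw [mem_ker_sub_add_one_iff hP hQ]
    have := reflection_apply_of_horizontal hZ (c := 1) (by simp)
      (reflection_apply_eq_self_iff.2 hx.1) (reflection_apply_eq_neg_iff.2 hx.2)
    rw [reflection_apply_eq_self_iff, reflection_apply_eq_neg_iff] at this
    exact ⟨⟨this.1, this.2.1⟩, this.2.2⟩

/-- Horizontal elements at a projection lift along surjective homomorphisms. -/
theorem exists_horizontal_lift {A B : Type*} [CStarAlgebra A] [CStarAlgebra B] (φ : A →⋆ₐ[ℂ] B)
    (hφ : Function.Surjective φ) {P : A} (hP : IsStarProjection P) {z : B}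
    (hz : z ∈ horizontalSpace (φ P)) : ∃ Z ∈ horizontalSpace P, φ Z = z := by
  obtain ⟨R, rfl⟩ := hφ z
  have hPP := hP.isIdempotentElem.eq
  have hPs := hP.isSelfAdjoint.star_eq
  have h0 : P * (1 - P) = 0 := by rw [mul_sub, hPP, mul_one, sub_self]
  have h0' : (1 - P) * P = 0 := by rw [sub_mul, hPP, one_mul, sub_self]
  have hst : star ((1 - P) * R * P) = P * star R * (1 - P) := by
    simp [star_mul, hPs, mul_assoc]
  -- An arbitrary lift `R` is cut to one off-diagonal corner and made antihermitian; `z`, being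
  -- horizontal, is recovered from that corner.
  refine ⟨(1 - P) * R * P - star ((1 - P) * R * P), ⟨?_, ?_, ?_⟩, ?_⟩
  · rw [star_sub, star_star, neg_sub]
  · rw [hst]
    calc _ = (P * (1 - P)) * R * P * P - P * P * star R * ((1 - P) * P) := by noncomm_ring
      _ = 0 := by rw [h0, h0']; simp
  · rw [hst]
    calc _ = (1 - P) * (1 - P) * R * (P * (1 - P)) -
          ((1 - P) * P) * star R * (1 - P) * (1 - P) := by
            simp only [mul_sub, sub_mul, mul_assoc]; abel
      _ = 0 := by rw [h0, h0']; simp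
  · rw [hst]
    simp only [map_sub, map_mul, map_one, map_star]
    rw [hz.1]
    have hcod := codiagonal_of_mem_horizontalSpace hz
    obtain ⟨-, h1, -⟩ := hz
    calc _ = φ P * φ R + φ R * φ P - (φ P * φ R * φ P + φ P * φ R * φ P) := by noncomm_ring
      _ = φ R := by rw [h1, ← hcod]; simp

theorem StarAlgHom.map_exp {A B : Type*} [CStarAlgebra A] [CStarAlgebra B] (φ : A →⋆ₐ[ℂ] B)
    (hφ : Continuous φ) (x : A) : φ (NormedSpace.exp x) = NormedSpace.exp (φ x) := by
  let +nondep : NormedAlgebra ℚ A := .restrictScalars ℚ ℂ A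
  let +nondep : NormedAlgebra ℚ B := .restrictScalars ℚ ℂ B
  exact NormedSpace.map_exp φ hφ x

theorem exists_lifts_of_isGeodesicJoining {p q : Calkin H} (hp : IsStarProjection p)
    {δ : ℝ → Calkin H} (hδ : IsGeodesicJoining δ p q) :
    ∃ P Q : H →L[ℂ] H, IsStarProjection P ∧ IsStarProjection Q ∧
        Calkin.π P = p ∧ Calkin.π Q = q ∧
        ((FiniteDimensional ℂ (P - Q - 1).ker ∧ FiniteDimensional ℂ (P - Q + 1).ker) ∨
          (¬ FiniteDimensional ℂ (P - Q - 1).ker ∧ ¬ FiniteDimensional ℂ (P - Q + 1).ker)) := by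
  obtain ⟨z, hz, rfl⟩ := exists_horizontal_of_isGeodesicJoining hδ
  obtain ⟨P, hP, rfl⟩ := Calkin.exists_isStarProjection_lift hp
  obtain ⟨Z, hZ, rfl⟩ := exists_horizontal_lift (Calkin.π (H := H)) (Calkin.π_surjective (H := H))
    hP hz
  refine ⟨P, NormedSpace.exp Z * P * NormedSpace.exp (-Z), hP, ?_, rfl, ?_, ?_⟩
  · simpa [conjExp] using isStarProjection_conjExp hZ.1 hP 1
  · have hexp := StarAlgHom.map_exp (Calkin.π (H := H)) (Calkin.continuous_π (H := H))
    rw [map_mul, map_mul, hexp, hexp, map_neg]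
  · have := finiteDimensional_ker_iff_of_horizontal hP hZ
    tauto

end GeodesicLifts

/-! ### Partial isometries between infinite dimensional subspaces. -/

section PartialIsometries

variable {H : Type*} [NormedAddCommGroup H] [InnerProductSpace ℂ H] [CompleteSpace H]

/-- Basis vectors are at mutual distance `√2`, so the balls of radius `1/2` around them are
disjoint. -/
theorem HilbertBasis.countable_of_separableSpace {ι E : Type*} [NormedAddCommGroup E]
    [InnerProductSpace ℂ E] [TopologicalSpace.SeparableSpace E] (b : HilbertBasis ι ℂ E) :
    Countable ι := by
  have hdist : Pairwise fun i j => 1 ≤ dist (b i) (b j) := fun i j hij => by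
    have h1 : dist (b i) (b j) ^ 2 = 2 := by
      rw [dist_eq_norm, @norm_sub_sq ℂ, b.orthonormal.1 i, b.orthonormal.1 j,
        b.orthonormal.2 hij]
      simp; norm_num
    nlinarith [dist_nonneg (x := b i) (y := b j)]
  have h := Set.PairwiseDisjoint.countable_of_isOpen (a := (Set.univ : Set ι))
    (s := fun i => Metric.ball (b i) (1 / 2))
    (fun i _ j _ hij => Metric.ball_disjoint_ball (by linarith [hdist hij]))
    (fun i _ => Metric.isOpen_ball) (fun i _ => ⟨b i, Metric.mem_ball_self (by norm_num)⟩)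
  exact Set.countable_univ_iff.1 h

theorem nonempty_linearIsometryEquiv_lp {E : Type*} [NormedAddCommGroup E]
    [InnerProductSpace ℂ E] [CompleteSpace E] [TopologicalSpace.SeparableSpace E]
    (h : ¬ FiniteDimensional ℂ E) : Nonempty (E ≃ₗᵢ[ℂ] lp (fun _ : ℕ => ℂ) 2) := by
  obtain ⟨w, b, -⟩ := exists_hilbertBasis ℂ E
  have hc : Countable w := b.countable_of_separableSpace
  have hi : Infinite w := by
    by_contra hfin
    rw [not_infinite_iff_finite] at hfin
    have := Fintype.ofFinite w
    exact h b.toOrthonormalBasis.toBasis.finiteDimensional_of_finite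
  obtain ⟨e⟩ : Nonempty (ℕ ≃ w) := nonempty_equiv_of_countable
  have hv : Orthonormal ℂ (b ∘ e) := b.orthonormal.comp e e.injective
  refine ⟨(HilbertBasis.mk hv ?_).repr⟩
  rw [Set.range_comp, e.range_eq_univ, Set.image_univ, b.dense_span]

/-- Two closed infinite dimensional subspaces of a separable Hilbert space are the initial and
final space of a partial isometry. -/
theorem exists_partialIsometry [TopologicalSpace.SeparableSpace H] (K L : Submodule ℂ H)
    [CompleteSpace K] [CompleteSpace L] (hK : ¬ FiniteDimensional ℂ K)
    (hL : ¬ FiniteDimensional ℂ L) :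
    ∃ J : H →L[ℂ] H, star J * J = K.starProjection ∧ J * star J = L.starProjection := by
  have : SecondCountableTopology H := UniformSpace.secondCountable_of_separable H
  obtain ⟨e₁⟩ := nonempty_linearIsometryEquiv_lp hK
  obtain ⟨e₂⟩ := nonempty_linearIsometryEquiv_lp hL
  let e : K ≃ₗᵢ[ℂ] L := e₁.trans e₂.symm
  let J : H →L[ℂ] H := L.subtypeL ∘L (e : K →L[ℂ] L) ∘L K.orthogonalProjectionOnto
  have hJ : star J = K.subtypeL ∘L (e.symm : L →L[ℂ] K) ∘L L.orthogonalProjectionOnto := by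
    rw [ContinuousLinearMap.star_eq_adjoint, ContinuousLinearMap.adjoint_comp,
      ContinuousLinearMap.adjoint_comp, Submodule.adjoint_subtypeL,
      Submodule.adjoint_orthogonalProjectionOnto, LinearIsometryEquiv.adjoint_eq_symm]
    rfl
  refine ⟨J, ?_, ?_⟩
  · rw [hJ]
    ext x
    simp [J]
  · rw [hJ]
    ext x
    simp [J]

end PartialIsometries

/-! ### Trigonometric identities for a pair of projections. -/

section SignOperators

variable {H : Type*} [NormedAddCommGroup H] [InnerProductSpace ℂ H] [CompleteSpace H]

open ProjectionManifold

section Algebra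

variable {A : Type*} [CStarAlgebra A]

/-- This identifies the exceptional part, where `(p - q)² = 1`, with the part where the cosine is
`-1`. -/
theorem cosTwoAngle_eq {p q : A} (hp : IsIdempotentElem p) (hq : IsIdempotentElem q) :
    cosTwoAngle p q = 1 - (2 : ℂ) • ((p - q) * (p - q)) := by
  have h : (2 * q - 1) * (2 * p - 1) + (2 * p - 1) * (2 * q - 1) =
      (1 + 1) - 4 * ((p - q) * (p - q)) := by
    have h1 : (p - q) * (p - q) = p * p + q * q - p * q - q * p := by noncomm_ring
    rw [h1, hp.eq, hq.eq]; noncomm_ring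
  rw [cosTwoAngle, h, smul_sub]
  have h4 : ∀ x : A, 4 * x = (4 : ℂ) • x := fun x => by
    rw [Algebra.smul_def, map_ofNat]
  rw [h4, ← two_smul ℂ (1 : A), smul_smul, smul_smul]
  norm_num

theorem skewPart_anticommute {p q : A} (hp : IsIdempotentElem p) :
    (2 * p - 1) * skewPart p q = -(skewPart p q * (2 * p - 1)) := by
  have h := reflection_mul_self hp
  rw [skewPart, mul_smul_comm, smul_mul_assoc, ← smul_neg]
  congr 1
  generalize 2 * p - 1 = s at *
  generalize 2 * q - 1 = r
  rw [mul_sub, sub_mul, ← mul_assoc s s r, h, mul_assoc r s s, h]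
  noncomm_ring

theorem commute_skewPart_cosTwoAngle {p q : A} (hp : IsIdempotentElem p)
    (hq : IsIdempotentElem q) : Commute (skewPart p q) (cosTwoAngle p q) := by
  have hs := reflection_mul_self hp
  have hr := reflection_mul_self hq
  refine (Commute.smul_right ?_ _).smul_left _
  generalize 2 * p - 1 = s at *
  generalize 2 * q - 1 = r at *
  have h1 : Commute (r * s) (s * r) := by
    rw [commute_iff_eq]
    calc r * s * (s * r) = r * (s * s) * r := by noncomm_ring
      _ = s * (r * r) * s := by rw [hs, hr, mul_one, mul_one, hs, hr]
      _ = _ := by noncomm_ring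
  exact ((Commute.refl _).add_right h1).sub_left (h1.symm.add_right (Commute.refl _))

theorem star_skewPart {p q : A} (hp : IsSelfAdjoint p) (hq : IsSelfAdjoint q) :
    star (skewPart p q) = -skewPart p q := by
  rw [skewPart, star_smul, star_sub, star_mul, star_mul, (isSelfAdjoint_reflection hp).star_eq,
    (isSelfAdjoint_reflection hq).star_eq, ← smul_neg, neg_sub]
  simp

theorem skewPart_mul_self {p q : A} (hp : IsIdempotentElem p) (hq : IsIdempotentElem q) :
    skewPart p q * skewPart p q = cosTwoAngle p q * cosTwoAngle p q - 1 := by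
  have hs := reflection_mul_self hp
  have hr := reflection_mul_self hq
  rw [skewPart, cosTwoAngle, smul_mul_smul_comm, smul_mul_smul_comm]
  generalize 2 * p - 1 = s at *
  generalize 2 * q - 1 = r at *
  have h1 : r * s * (s * r) = 1 := by
    calc r * s * (s * r) = r * (s * s) * r := by noncomm_ring
      _ = 1 := by rw [hs, mul_one, hr]
  have h2 : s * r * (r * s) = 1 := by
    calc s * r * (r * s) = s * (r * r) * s := by noncomm_ring
      _ = 1 := by rw [hr, mul_one, hs]
  have h3 : (r * s - s * r) * (r * s - s * r) =
      (r * s + s * r) * (r * s + s * r) - (4 : ℂ) • (1 : A) := by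
    have h4 : (4 : ℂ) • (1 : A) = 4 * 1 := by rw [Algebra.smul_def, map_ofNat]
    have : (r * s - s * r) * (r * s - s * r) = (r * s + s * r) * (r * s + s * r) -
        2 * (r * s * (s * r)) - 2 * (s * r * (r * s)) := by noncomm_ring
    rw [this, h1, h2, h4]; noncomm_ring
  rw [h3, smul_sub, smul_smul]
  norm_num

/-- The imaginary part of the product of the reflections of a pair of projections. -/
noncomputable def sinTwoAngle (p q : A) : A := (-Complex.I) • skewPart p q

theorem I_smul_sinTwoAngle (p q : A) : Complex.I • sinTwoAngle p q = skewPart p q := by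
  rw [sinTwoAngle, smul_smul]; simp

theorem isSelfAdjoint_sinTwoAngle {p q : A} (hp : IsSelfAdjoint p) (hq : IsSelfAdjoint q) :
    IsSelfAdjoint (sinTwoAngle p q) := by
  rw [isSelfAdjoint_iff, sinTwoAngle, star_smul, star_skewPart hp hq]
  simp

theorem sinTwoAngle_mul_self {p q : A} (hp : IsIdempotentElem p) (hq : IsIdempotentElem q) :
    sinTwoAngle p q * sinTwoAngle p q = 1 - cosTwoAngle p q * cosTwoAngle p q := by
  rw [sinTwoAngle, smul_mul_smul_comm, skewPart_mul_self hp hq]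
  simp

theorem sqrt_one_sub_sq_cosTwoAngle {p q : A} (hp : IsStarProjection p)
    (hq : IsStarProjection q) :
    cfc (fun x : ℝ => √(1 - x ^ 2)) (cosTwoAngle p q) =
      positivePart (sinTwoAngle p q) + negativePart (sinTwoAngle p q) := by
  have hc := isSelfAdjoint_cosTwoAngle hp hq
  rw [positivePart_add_negativePart (isSelfAdjoint_sinTwoAngle hp.isSelfAdjoint hq.isSelfAdjoint),
    sinTwoAngle_mul_self hp.isIdempotentElem hq.isIdempotentElem, cfc_comp' Real.sqrt
    (fun x : ℝ => 1 - x ^ 2) _, cfc_sub _ _ _, cfc_const_one ℝ _, cfc_pow_id _ 2, sq]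

end Algebra

end SignOperators

/-! ### Completing the sign operator and building the short geodesic. -/

section ShortGeodesics

variable {H : Type*} [NormedAddCommGroup H] [InnerProductSpace ℂ H] [CompleteSpace H]

open ProjectionManifold Real

/-- The sum of the projections onto the null spaces of `P - Q - 1` and `P - Q + 1`. -/
noncomputable def exceptionalProj (P Q : H →L[ℂ] H) : H →L[ℂ] H :=
  kerProj (P - Q - 1) + kerProj (P - Q + 1)

/-- The sign of `sinTwoAngle P Q`: it vanishes on the null space of this operator. -/
noncomputable def sinSign (P Q : H →L[ℂ] H) : H →L[ℂ] H :=
  kerProj (negativePart (sinTwoAngle P Q)) - kerProj (positivePart (sinTwoAngle P Q))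

theorem isSelfAdjoint_sub_sub_one {P Q : H →L[ℂ] H} (hP : IsStarProjection P)
    (hQ : IsStarProjection Q) : IsSelfAdjoint (P - Q - 1) :=
  (hP.isSelfAdjoint.sub hQ.isSelfAdjoint).sub (.one _)

theorem isSelfAdjoint_sub_add_one {P Q : H →L[ℂ] H} (hP : IsStarProjection P)
    (hQ : IsStarProjection Q) : IsSelfAdjoint (P - Q + 1) :=
  (hP.isSelfAdjoint.sub hQ.isSelfAdjoint).add (.one _)

theorem sub_mul_kerProj_sub_one (P Q : H →L[ℂ] H) :
    (P - Q) * kerProj (P - Q - 1) = kerProj (P - Q - 1) := by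
  have := mul_kerProj (P - Q - 1)
  rwa [sub_mul _ 1, one_mul, sub_eq_zero] at this

theorem sub_mul_kerProj_add_one (P Q : H →L[ℂ] H) :
    (P - Q) * kerProj (P - Q + 1) = -kerProj (P - Q + 1) := by
  have := mul_kerProj (P - Q + 1)
  rw [add_mul _ 1, one_mul] at this
  exact eq_neg_of_add_eq_zero_left this

theorem kerProj_sub_one_mul_sub {P Q : H →L[ℂ] H} (hP : IsStarProjection P)
    (hQ : IsStarProjection Q) : kerProj (P - Q - 1) * (P - Q) = kerProj (P - Q - 1) := by
  have := kerProj_mul (isSelfAdjoint_sub_sub_one hP hQ)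
  rwa [mul_sub _ _ 1, mul_one, sub_eq_zero] at this

theorem kerProj_add_one_mul_sub {P Q : H →L[ℂ] H} (hP : IsStarProjection P)
    (hQ : IsStarProjection Q) : kerProj (P - Q + 1) * (P - Q) = -kerProj (P - Q + 1) := by
  have := kerProj_mul (isSelfAdjoint_sub_add_one hP hQ)
  rw [mul_add _ _ 1, mul_one] at this
  exact eq_neg_of_add_eq_zero_left this

theorem star_exceptionalProj (P Q : H →L[ℂ] H) :
    star (exceptionalProj P Q) = exceptionalProj P Q := by
  rw [exceptionalProj, star_add, star_kerProj, star_kerProj]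

theorem cosTwoAngle_mul_exceptionalProj {P Q : H →L[ℂ] H} (hP : IsStarProjection P)
    (hQ : IsStarProjection Q) :
    cosTwoAngle P Q * exceptionalProj P Q = -exceptionalProj P Q := by
  have h : (P - Q) * (P - Q) * exceptionalProj P Q = exceptionalProj P Q := by
    rw [exceptionalProj, mul_assoc, mul_add, sub_mul_kerProj_sub_one, sub_mul_kerProj_add_one,
      mul_add, mul_neg, sub_mul_kerProj_sub_one, sub_mul_kerProj_add_one, neg_neg]
  rw [cosTwoAngle_eq hP.isIdempotentElem hQ.isIdempotentElem, sub_mul, smul_mul_assoc, h, one_mul,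
    two_smul]
  abel

theorem exceptionalProj_mul_cosTwoAngle {P Q : H →L[ℂ] H} (hP : IsStarProjection P)
    (hQ : IsStarProjection Q) :
    exceptionalProj P Q * cosTwoAngle P Q = -exceptionalProj P Q := by
  have := congrArg star (cosTwoAngle_mul_exceptionalProj hP hQ)
  rwa [star_mul, star_neg, star_exceptionalProj, (isSelfAdjoint_cosTwoAngle hP hQ).star_eq] at this

theorem sinTwoAngle_mul_exceptionalProj {P Q : H →L[ℂ] H} (hP : IsStarProjection P)
    (hQ : IsStarProjection Q) : sinTwoAngle P Q * exceptionalProj P Q = 0 := by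
  have hD := isSelfAdjoint_sinTwoAngle hP.isSelfAdjoint hQ.isSelfAdjoint
  rw [← CStarRing.star_mul_self_eq_zero_iff, star_mul, hD.star_eq, mul_assoc,
    ← mul_assoc (sinTwoAngle P Q),
    sinTwoAngle_mul_self hP.isIdempotentElem hQ.isIdempotentElem, sub_mul, mul_assoc,
    cosTwoAngle_mul_exceptionalProj hP hQ, mul_neg, cosTwoAngle_mul_exceptionalProj hP hQ, neg_neg,
    one_mul, sub_self, mul_zero]

/-- An element annihilated by `1 + cos` is supported on the exceptional subspaces. -/
theorem exceptionalProj_mul_eq_self {P Q Y : H →L[ℂ] H} (hP : IsStarProjection P)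
    (hQ : IsStarProjection Q) (hY : (1 + cosTwoAngle P Q) * Y = 0) :
    exceptionalProj P Q * Y = Y := by
  have h0 : (P - Q) * (P - Q) * Y = Y := by
    rw [cosTwoAngle_eq hP.isIdempotentElem hQ.isIdempotentElem, add_mul, sub_mul, one_mul,
      smul_mul_assoc, ← add_sub_assoc, ← two_smul ℂ, ← smul_sub] at hY
    exact (sub_eq_zero.1 ((smul_eq_zero.1 hY).resolve_left two_ne_zero)).symm
  -- As `(P - Q)² Y = Y`, the two combinations `Y ± (P - Q) Y` lie in the eigenspaces of `P - Q` for
  -- `±1`, and they add up to `2Y`.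
  have h1 := kerProj_mul_of_mul_eq_zero (X := P - Q - 1) (Y := (P - Q) * Y + Y) (by
    rw [sub_mul _ 1, mul_add, ← mul_assoc, h0, one_mul]; abel)
  have h2 := kerProj_mul_of_mul_eq_zero (X := P - Q + 1) (Y := Y - (P - Q) * Y) (by
    rw [add_mul _ 1, mul_sub, ← mul_assoc, h0, one_mul]; abel)
  rw [mul_add, ← mul_assoc, kerProj_sub_one_mul_sub hP hQ] at h1
  rw [mul_sub, ← mul_assoc, kerProj_add_one_mul_sub hP hQ] at h2
  refine smul_right_injective _ (two_ne_zero' ℂ) ?_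
  simp only [two_smul, exceptionalProj, add_mul]
  calc _ = (kerProj (P - Q - 1) * Y + kerProj (P - Q - 1) * Y) +
        (kerProj (P - Q + 1) * Y - -kerProj (P - Q + 1) * Y) := by rw [neg_mul]; abel
    _ = Y + Y := by rw [h1, h2]; abel

theorem isSelfAdjoint_sinSign (P Q : H →L[ℂ] H) : IsSelfAdjoint (sinSign P Q) :=
  (isStarProjection_kerProj _).isSelfAdjoint.sub (isStarProjection_kerProj _).isSelfAdjoint

/-- The symmetry anticommutes with the sine, so it exchanges its positive and negative parts and
hence their kernel projections. -/
theorem sinSign_anticommute {P Q : H →L[ℂ] H} (hP : IsStarProjection P)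
    (hQ : IsStarProjection Q) : (2 * P - 1) * sinSign P Q = -(sinSign P Q * (2 * P - 1)) := by
  have hs := isSelfAdjoint_reflection hP.isSelfAdjoint
  have hss := reflection_mul_self hP.isIdempotentElem
  have hD := isSelfAdjoint_sinTwoAngle hP.isSelfAdjoint hQ.isSelfAdjoint
  have h1 : SemiconjBy (2 * P - 1) (positivePart (sinTwoAngle P Q))
      (negativePart (sinTwoAngle P Q)) := by
    refine semiconjBy_positivePart_negativePart hs hss hD ?_
    rw [sinTwoAngle, mul_smul_comm, skewPart_anticommute hP.isIdempotentElem, smul_mul_assoc,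
      smul_neg]
  have h2 := h1.kerProj (isSelfAdjoint_positivePart _) (isSelfAdjoint_negativePart _)
  have h3 := congrArg star h2.eq
  rw [star_mul, star_mul, star_kerProj, star_kerProj, hs.star_eq] at h3
  rw [sinSign, mul_sub, sub_mul (kerProj _) (kerProj _) (2 * P - 1), h2.eq, ← h3, neg_sub]

theorem commute_sinTwoAngle_cosTwoAngle {P Q : H →L[ℂ] H} (hP : IsStarProjection P)
    (hQ : IsStarProjection Q) : Commute (sinTwoAngle P Q) (cosTwoAngle P Q) :=
  (commute_skewPart_cosTwoAngle hP.isIdempotentElem hQ.isIdempotentElem).smul_left _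

theorem commute_sinSign_cosTwoAngle {P Q : H →L[ℂ] H} (hP : IsStarProjection P)
    (hQ : IsStarProjection Q) : Commute (sinSign P Q) (cosTwoAngle P Q) := by
  have h := commute_sinTwoAngle_cosTwoAngle hP hQ
  exact (h.negativePart.kerProj (isSelfAdjoint_negativePart _)).sub_left
    (h.positivePart.kerProj (isSelfAdjoint_positivePart _))

/-- The exceptional subspaces lie in the null spaces of both parts of the sine, so the two kernel
projections cancel there. -/
theorem sinSign_mul_exceptionalProj {P Q : H →L[ℂ] H} (hP : IsStarProjection P)
    (hQ : IsStarProjection Q) : sinSign P Q * exceptionalProj P Q = 0 := by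
  have hD := isSelfAdjoint_sinTwoAngle hP.isSelfAdjoint hQ.isSelfAdjoint
  have h := sinTwoAngle_mul_exceptionalProj hP hQ
  rw [sinSign, sub_mul, kerProj_mul_of_mul_eq_zero (positivePart_mul_eq_zero hD h),
    kerProj_mul_of_mul_eq_zero (negativePart_mul_eq_zero hD h), sub_self]

theorem sinSign_mul_sqrt {P Q : H →L[ℂ] H} (hP : IsStarProjection P)
    (hQ : IsStarProjection Q) :
    sinSign P Q * cfc (fun x : ℝ => √(1 - x ^ 2)) (cosTwoAngle P Q) = sinTwoAngle P Q := by
  have hD := isSelfAdjoint_sinTwoAngle hP.isSelfAdjoint hQ.isSelfAdjoint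
  have e1 : kerProj (negativePart (sinTwoAngle P Q)) * positivePart (sinTwoAngle P Q) =
      positivePart (sinTwoAngle P Q) :=
    kerProj_mul_of_mul_eq_zero (negativePart_mul_positivePart _)
  have e2 : kerProj (positivePart (sinTwoAngle P Q)) * negativePart (sinTwoAngle P Q) =
      negativePart (sinTwoAngle P Q) :=
    kerProj_mul_of_mul_eq_zero (positivePart_mul_negativePart _)
  have e3 := kerProj_mul (isSelfAdjoint_positivePart (sinTwoAngle P Q))
  have e4 := kerProj_mul (isSelfAdjoint_negativePart (sinTwoAngle P Q))
  rw [sqrt_one_sub_sq_cosTwoAngle hP hQ, sinSign, sub_mul, mul_add, mul_add, e1, e2, e3, e4,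
    add_zero, zero_add, positivePart_sub_negativePart hD]

/-- The defect `1 - V²` is the projection onto `ker D`. There `(1 + C)(1 - C) = D² = 0`, so `1 - C`
is supported where `C = -1`, the exceptional part. -/
theorem one_sub_sinSign_mul_self {P Q : H →L[ℂ] H} (hP : IsStarProjection P)
    (hQ : IsStarProjection Q) :
    (1 - sinSign P Q * sinSign P Q) * (1 - cosTwoAngle P Q) =
      exceptionalProj P Q * (1 - cosTwoAngle P Q) := by
  have hD := isSelfAdjoint_sinTwoAngle hP.isSelfAdjoint hQ.isSelfAdjoint
  have hDD := sinTwoAngle_mul_self hP.isIdempotentElem hQ.isIdempotentElem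
  have hDC := commute_sinTwoAngle_cosTwoAngle hP hQ
  have hDN := sinTwoAngle_mul_exceptionalProj hP hQ
  have hCN := cosTwoAngle_mul_exceptionalProj hP hQ
  have hNC := exceptionalProj_mul_cosTwoAngle hP hQ
  have hN := star_exceptionalProj P Q
  have hY := @exceptionalProj_mul_eq_self H _ _ _ P Q
  rw [sinSign]
  set D := sinTwoAngle P Q
  set C := cosTwoAngle P Q
  set N := exceptionalProj P Q
  set E₁ := kerProj (positivePart D) with hE₁
  set E₂ := kerProj (negativePart D) with hE₂
  have h11 : E₁ * E₁ = E₁ := (isStarProjection_kerProj _).isIdempotentElem.eq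
  have h22 : E₂ * E₂ = E₂ := (isStarProjection_kerProj _).isIdempotentElem.eq
  -- The support of `D₊` is contained in the null space of `D₋`.
  have hEE : E₂ * (1 - E₁) = 1 - E₁ := kerProj_mul_of_mul_eq_zero (by
    rw [mul_sub, mul_one, mul_kerProj_of_mul_eq_zero (isSelfAdjoint_positivePart _)
      (negativePart_mul_positivePart _), sub_self])
  have h21 : E₂ * E₁ = E₁ + E₂ - 1 := by
    rw [mul_sub, mul_one] at hEE
    rw [← sub_sub_cancel E₂ (E₂ * E₁), hEE]; abel
  have h12 : E₁ * E₂ = E₁ + E₂ - 1 := by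
    have := congrArg star h21
    simpa only [star_mul, star_sub, star_add, star_one, hE₁, hE₂, star_kerProj] using this
  have hsq : 1 - (E₂ - E₁) * (E₂ - E₁) = E₁ * E₂ := by
    rw [sub_mul, mul_sub, mul_sub, h11, h22, h21, h12]; abel
  have hDE : D * (E₁ * E₂) = 0 := by
    have e1 : positivePart D * (E₁ * E₂) = 0 := by
      rw [← mul_assoc, mul_kerProj, zero_mul]
    have e2 : negativePart D * (E₁ * E₂) = 0 := by
      rw [h12, ← h21, ← mul_assoc, mul_kerProj, zero_mul]
    rw [← positivePart_sub_negativePart hD, sub_mul, e1, e2, sub_zero]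
  have hCE : Commute C (E₁ * E₂) :=
    ((hDC.positivePart.kerProj (isSelfAdjoint_positivePart _)).mul_left
      (hDC.negativePart.kerProj (isSelfAdjoint_negativePart _))).symm
  have h1 : N * ((1 - C) * (E₁ * E₂)) = (1 - C) * (E₁ * E₂) := by
    refine hY hP hQ ?_
    have : (1 + C) * ((1 - C) * (E₁ * E₂)) = (1 - C * C) * (E₁ * E₂) := by noncomm_ring
    rw [this, ← hDD, mul_assoc, hDE, mul_zero]
  have hNE₁ : N * E₁ = N := by
    have := congrArg star (kerProj_mul_of_mul_eq_zero (positivePart_mul_eq_zero hD hDN))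
    rwa [star_mul, star_kerProj, hN] at this
  have hNE₂ : N * E₂ = N := by
    have := congrArg star (kerProj_mul_of_mul_eq_zero (negativePart_mul_eq_zero hD hDN))
    rwa [star_mul, star_kerProj, hN] at this
  rw [hsq, mul_sub, mul_one, ← hCE.eq, ← one_sub_mul, ← h1, ← mul_assoc, mul_sub, mul_one, hNC,
    sub_neg_eq_add, add_mul, ← mul_assoc, hNE₁, hNE₂]

/-- When both exceptional subspaces are infinite dimensional, they are interchanged by a symmetry
anticommuting with the reflection of `P`. -/
theorem exists_exceptional_symmetry [TopologicalSpace.SeparableSpace H] {P Q : H →L[ℂ] H}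
    (hP : IsStarProjection P) (hQ : IsStarProjection Q)
    (h₁ : ¬ FiniteDimensional ℂ (P - Q - 1).ker) (h₂ : ¬ FiniteDimensional ℂ (P - Q + 1).ker) :
    ∃ W : H →L[ℂ] H, IsSelfAdjoint W ∧ W * W = exceptionalProj P Q ∧
      W * exceptionalProj P Q = W ∧ (2 * P - 1) * W = -(W * (2 * P - 1)) := by
  obtain ⟨J, hJ₁, hJ₂⟩ := exists_partialIsometry _ _ h₁ h₂
  set E₁ := kerProj (P - Q - 1) with hE₁
  set E₂ := kerProj (P - Q + 1) with hE₂
  change star J * J = E₁ at hJ₁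
  change J * star J = E₂ at hJ₂
  have hs₁ : star E₁ = E₁ := star_kerProj _
  have hs₂ : star E₂ = E₂ := star_kerProj _
  have h11 : E₁ * E₁ = E₁ := (isStarProjection_kerProj _).isIdempotentElem.eq
  have hJE : J * E₁ = J := by
    rw [← sub_eq_zero, ← CStarRing.star_mul_self_eq_zero_iff]
    rw [star_sub, star_mul, hs₁, sub_mul, mul_sub, mul_sub]
    simp only [← mul_assoc, hJ₁]
    simp only [mul_assoc, hJ₁, h11]
    abel
  have hEJ : E₂ * J = J := by rw [← hJ₂, mul_assoc, hJ₁, hJE]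
  have hEE : E₁ * E₂ = 0 := by
    have e : E₁ * E₂ = -(E₁ * E₂) := by
      conv_lhs => rw [hE₁, ← kerProj_sub_one_mul_sub hP hQ, mul_assoc, hE₂,
        sub_mul_kerProj_add_one, mul_neg]
    have e2 : (2 : ℂ) • (E₁ * E₂) = 0 := by
      rw [two_smul]
      nth_rw 1 [e]
      exact neg_add_cancel _
    exact (smul_eq_zero.1 e2).resolve_left two_ne_zero
  have hEE' : E₂ * E₁ = 0 := by
    have := congrArg star hEE
    rwa [star_mul, hs₁, hs₂, star_zero] at this
  have hJJ : J * J = 0 := by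
    calc J * J = (J * E₁) * (E₂ * J) := by rw [hJE, hEJ]
      _ = J * (E₁ * E₂) * J := by simp only [mul_assoc]
      _ = 0 := by rw [hEE, mul_zero, zero_mul]
  have hJE₂ : J * E₂ = 0 := by rw [← hJE, mul_assoc, hEE, mul_zero]
  have hJs : star J * star J = 0 := by rw [← star_mul, hJJ, star_zero]
  have hsJ₁ : star J * E₁ = 0 := by
    rw [← hEJ, star_mul, hs₂, mul_assoc, hEE', mul_zero]
  have hsJ₂ : star J * E₂ = star J := by
    conv_rhs => rw [← hEJ, star_mul, hs₂]
  have hPE₁ : P * E₁ = E₁ := by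
    ext x
    exact ((mem_ker_sub_sub_one_iff hP hQ).1 (Submodule.starProjection_apply_mem _ x)).1
  have hPE₂ : P * E₂ = 0 := by
    ext x
    exact ((mem_ker_sub_add_one_iff hP hQ).1 (Submodule.starProjection_apply_mem _ x)).1
  -- `J` starts in a subspace of the range of `P` and ends in a subspace of its null space, so the
  -- symmetry acts as `1` on one side and `-1` on the other.
  have hsJ : (2 * P - 1) * J = -J := by
    rw [← hEJ, sub_mul, mul_assoc, ← mul_assoc P, hPE₂]; simp
  have hJs' : J * (2 * P - 1) = J := by
    have hEP : E₁ * P = E₁ := by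
      have := congrArg star hPE₁
      rwa [star_mul, hs₁, hP.isSelfAdjoint.star_eq] at this
    rw [← hJE, mul_assoc, mul_sub, two_mul, mul_add, hEP, mul_one, add_sub_cancel_right]
  have hs := (isSelfAdjoint_reflection hP.isSelfAdjoint).star_eq
  have hsJ' : star J * (2 * P - 1) = -star J := by
    have := congrArg star hsJ
    rwa [star_mul, hs, star_neg] at this
  have hJs'' : (2 * P - 1) * star J = star J := by
    have := congrArg star hJs'
    rwa [star_mul, hs] at this
  refine ⟨J + star J, ?_, ?_, ?_, ?_⟩
  · rw [isSelfAdjoint_iff, star_add, star_star, add_comm]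
  · rw [add_mul, mul_add, mul_add, hJJ, hJ₁, hJ₂, hJs, zero_add, add_zero, add_comm]
    rfl
  · rw [exceptionalProj, mul_add, add_mul, add_mul, hJE, hJE₂, hsJ₁, hsJ₂]
    abel
  · rw [mul_add, add_mul, hsJ, hJs', hsJ', hJs'']
    abel

theorem map_cosTwoAngle {A B : Type*} [CStarAlgebra A] [CStarAlgebra B] (φ : A →⋆ₐ[ℂ] B)
    (p q : A) : φ (cosTwoAngle p q) = cosTwoAngle (φ p) (φ q) := by
  simp [cosTwoAngle, two_mul]

theorem map_skewPart {A B : Type*} [CStarAlgebra A] [CStarAlgebra B] (φ : A →⋆ₐ[ℂ] B)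
    (p q : A) : φ (skewPart p q) = skewPart (φ p) (φ q) := by
  simp [skewPart, two_mul]

/-- An operator which is the sign of the skew part up to the kernel of a homomorphism yields a
short geodesic in the target of the homomorphism. -/
theorem exists_horizontal_of_sign_map {A B : Type*} [CStarAlgebra A] [CStarAlgebra B]
    (φ : A →⋆ₐ[ℂ] B) (hφ : Continuous φ) {P Q V : A} (hP : IsStarProjection P)
    (hQ : IsStarProjection Q) (hV : IsSelfAdjoint V)
    (hVP : (2 * P - 1) * V = -(V * (2 * P - 1))) (hVC : Commute V (cosTwoAngle P Q))
    (hVV : φ ((1 - V * V) * (1 - cosTwoAngle P Q)) = 0)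
    (hVD : V * cfc (fun x : ℝ => √(1 - x ^ 2)) (cosTwoAngle P Q) = sinTwoAngle P Q) :
    ∃ z ∈ horizontalSpace (φ P), ‖z‖ ≤ π / 2 ∧
      NormedSpace.exp z * φ P * NormedSpace.exp (-z) = φ Q := by
  have hc := isSelfAdjoint_cosTwoAngle hP hQ
  refine exists_horizontal_of_sign (hP.map φ) (hQ.map φ) (hV.map φ) ?_ ?_ ?_ ?_
  · simpa [two_mul] using congrArg φ hVP
  · rw [← map_cosTwoAngle]; exact hVC.map φ
  · rw [← map_cosTwoAngle]
    simpa using hVV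
  · rw [← map_cosTwoAngle, ← StarAlgHom.map_cfc φ _ _ (by fun_prop) hφ hc (hc.map φ), ← map_mul,
      hVD, ← map_smul, I_smul_sinTwoAngle, map_skewPart]

/-- `sinSign` fails to be a full sign only on the exceptional part. That part is compact in the
first case, and is filled by a symmetry `W` in the second. -/
theorem exists_short_horizontal [TopologicalSpace.SeparableSpace H] {P Q : H →L[ℂ] H}
    (hP : IsStarProjection P) (hQ : IsStarProjection Q)
    (h : (FiniteDimensional ℂ (P - Q - 1).ker ∧ FiniteDimensional ℂ (P - Q + 1).ker) ∨
      (¬ FiniteDimensional ℂ (P - Q - 1).ker ∧ ¬ FiniteDimensional ℂ (P - Q + 1).ker)) :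
    ∃ z ∈ horizontalSpace (Calkin.π P), ‖z‖ ≤ π / 2 ∧
      NormedSpace.exp z * Calkin.π P * NormedSpace.exp (-z) = Calkin.π Q := by
  have hφ := Calkin.continuous_π (H := H)
  have hVN := sinSign_mul_exceptionalProj hP hQ
  have hVV := one_sub_sinSign_mul_self hP hQ
  have hV := isSelfAdjoint_sinSign P Q
  rcases h with ⟨h₁, h₂⟩ | ⟨h₁, h₂⟩
  · refine exists_horizontal_of_sign_map (Calkin.π (H := H)) hφ hP hQ hV
      (sinSign_anticommute hP hQ) (commute_sinSign_cosTwoAngle hP hQ) ?_ (sinSign_mul_sqrt hP hQ)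
    have hN : Calkin.π (exceptionalProj P Q) = 0 :=
      Calkin.π_eq_zero_of_isCompactOperator
        ((isCompactOperator_starProjection _).add (isCompactOperator_starProjection _))
    rw [hVV, map_mul, hN, zero_mul]
  · obtain ⟨W, hW, hWW, hWN, hWP⟩ := exists_exceptional_symmetry hP hQ h₁ h₂
    have hN := star_exceptionalProj P Q
    have hNW : exceptionalProj P Q * W = W := by
      have := congrArg star hWN
      rwa [star_mul, hN, hW.star_eq] at this
    have hVW : sinSign P Q * W = 0 := by rw [← hNW, ← mul_assoc, hVN, zero_mul]
    have hWV : W * sinSign P Q = 0 := by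
      have := congrArg star hVW
      rwa [star_mul, hV.star_eq, hW.star_eq, star_zero] at this
    -- `W` squares to the exceptional projection and is orthogonal to `sinSign P Q`, so it removes
    -- the defect exactly. It kills the sine, so the polar identity is unaffected.
    refine exists_horizontal_of_sign_map (V := sinSign P Q + W) (Calkin.π (H := H)) hφ hP hQ
      (hV.add hW) ?_ ?_ ?_ ?_
    · rw [mul_add, add_mul, sinSign_anticommute hP hQ, hWP, neg_add]
    · refine (commute_sinSign_cosTwoAngle hP hQ).add_left ?_
      have e1 : W * cosTwoAngle P Q = -W := by
        rw [← hWN, mul_assoc, exceptionalProj_mul_cosTwoAngle hP hQ, mul_neg]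
      have e2 : cosTwoAngle P Q * W = -W := by
        rw [← hNW, ← mul_assoc, cosTwoAngle_mul_exceptionalProj hP hQ, neg_mul]
      rw [commute_iff_eq, e1, e2]
    · have e : 1 - (sinSign P Q + W) * (sinSign P Q + W) =
          (1 - sinSign P Q * sinSign P Q) - exceptionalProj P Q := by
        rw [add_mul, mul_add, mul_add, hVW, hWV, hWW]; abel
      rw [e, sub_mul, hVV, sub_self, map_zero]
    · have hD := isSelfAdjoint_sinTwoAngle hP.isSelfAdjoint hQ.isSelfAdjoint
      have hDN := sinTwoAngle_mul_exceptionalProj hP hQ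
      have e1 : W * positivePart (sinTwoAngle P Q) = 0 := by
        have := congrArg star (positivePart_mul_eq_zero hD hDN)
        rw [star_mul, hN, (isSelfAdjoint_positivePart _).star_eq, star_zero] at this
        rw [← hWN, mul_assoc, this, mul_zero]
      have e2 : W * negativePart (sinTwoAngle P Q) = 0 := by
        have := congrArg star (negativePart_mul_eq_zero hD hDN)
        rw [star_mul, hN, (isSelfAdjoint_negativePart _).star_eq, star_zero] at this
        rw [← hWN, mul_assoc, this, mul_zero]
      have e3 : W * cfc (fun x : ℝ => √(1 - x ^ 2)) (cosTwoAngle P Q) = 0 := by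
        rw [sqrt_one_sub_sq_cosTwoAngle hP hQ, mul_add, e1, e2, add_zero]
      rw [add_mul, sinSign_mul_sqrt hP hQ, e3, add_zero]

end ShortGeodesics

theorem mainTheorem1 {H : Type*} [NormedAddCommGroup H] [InnerProductSpace ℂ H] [CompleteSpace H]
    [TopologicalSpace.SeparableSpace H] (p q : Calkin H)
    (hp : IsStarProjection p) (hp0 : p ≠ 0) (hp1 : p ≠ 1)
    (hq : IsStarProjection q) (hq0 : q ≠ 0) (hq1 : q ≠ 1) :
    ((∃ δ : ℝ → Calkin H, ProjectionManifold.IsGeodesicJoining δ p q) ↔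
      ∃ P Q : H →L[ℂ] H, IsStarProjection P ∧ IsStarProjection Q ∧
        Calkin.π P = p ∧ Calkin.π Q = q ∧
        ((FiniteDimensional ℂ (P - Q - 1).ker ∧ FiniteDimensional ℂ (P - Q + 1).ker) ∨
          (¬ FiniteDimensional ℂ (P - Q - 1).ker ∧ ¬ FiniteDimensional ℂ (P - Q + 1).ker))) ∧
    ((∃ δ : ℝ → Calkin H, ProjectionManifold.IsGeodesicJoining δ p q) →
      ∃ δ : ℝ → Calkin H, ProjectionManifold.IsGeodesicJoining δ p q ∧
        ProjectionManifold.IsMinimal δ) := by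
  have key : (∃ P Q : H →L[ℂ] H, IsStarProjection P ∧ IsStarProjection Q ∧
        Calkin.π P = p ∧ Calkin.π Q = q ∧
        ((FiniteDimensional ℂ (P - Q - 1).ker ∧ FiniteDimensional ℂ (P - Q + 1).ker) ∨
          (¬ FiniteDimensional ℂ (P - Q - 1).ker ∧ ¬ FiniteDimensional ℂ (P - Q + 1).ker))) →
      ∃ δ : ℝ → Calkin H, ProjectionManifold.IsGeodesicJoining δ p q ∧
        ProjectionManifold.IsMinimal δ := by
    rintro ⟨P, Q, hP, hQ, rfl, rfl, h⟩
    obtain ⟨z, hz, hzn, hzq⟩ := exists_short_horizontal hP hQ h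
    exact ⟨ProjectionManifold.conjExp z (Calkin.π P),
      hzq ▸ ProjectionManifold.isGeodesicJoining_conjExp hp hz,
      ProjectionManifold.isMinimal_conjExp hp hz hzn⟩
  have lift : (∃ δ : ℝ → Calkin H, ProjectionManifold.IsGeodesicJoining δ p q) → _ :=
    fun ⟨δ, hδ⟩ => exists_lifts_of_isGeodesicJoining hp hδ
  -- The given geodesic need not be minimal; it only supplies lifts, from which a short one is
  -- rebuilt.
  refine ⟨⟨lift, fun h => ?_⟩, fun h => key (lift h)⟩
  obtain ⟨δ, hδ, -⟩ := key h
  exact ⟨δ, hδ⟩
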